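/- Let $\mathbb H=\{(z_1,z_2)\in\mathbb C^2: |z_1|<|z_2|<1\}$ be the Hartogs triangle with Lebesgue measure $dV$, and let $P$ be its Bergman projection, i.e. the orthogonal projection from $L^2(\mathbb H)$ onto the closed subspace $A^2(\mathbb H)$ of square-integrable holomorphic functions. For $1\le p\le\infty$, say that $P$ is bounded on $L^p(\mathbb H)$ if there is a bounded linear operator on $L^p(\mathbb H)$ which agrees with $P$ on $L^2(\mathbb H)\cap L^p(\mathbb H)$; this operator is unique, is again denoted by $P$, and its operator norm is $\|P\|_{L^p(\mathbb H)}$. Then: 1. For $1\le p\le\infty$, $P$ is bounded on $L^p(\mathbb H)$ if and only if $\frac43<p<4$. 2. There is an absolute constant $C>0$ such that for all $p\in(\frac43,4)$, with $\frac1p+\frac1{p'}=1$, $$\|P\|_{L^p(\mathbb H)}\le C\,(4-p)^{-1/p}(3p-4)^{-1/p'}.$$ 3. This estimate is sharp: there are absolute constants $0<c\le C'$ such that for all $p\in(\frac43,4)$ the function $f_p(z)=|z_2|^{-p'}\bar z_2$ belongs to $L^p(\mathbb H)$ and $$c\,(4-p)^{-1/p}(3p-4)^{-1/p'}\le\frac{\|P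 f_p\|_{L^p(\mathbb H)}}{\|f_p\|_{L^p(\mathbb H)}}\le C'(4-p)^{-1/p}(3p-4)^{-1/p'}.$$ -/

import Mathlib

open MeasureTheory Metric Filter Topology
open scoped ENNReal

/-- The Bergman space `A²(Ω)` of square-integrable holomorphic functions on `Ω ⊆ ℂ²`, as a subspace
of `L²(Ω)` for Lebesgue measure: the classes that have a representative holomorphic on `Ω`. -/
def bergmanSpace (Ω : Set (ℂ × ℂ)) : Submodule ℂ (Lp ℂ 2 (volume.restrict Ω)) where
  carrier := {f | ∃ g : ℂ × ℂ → ℂ, DifferentiableOn ℂ g Ω ∧ f =ᵐ[volume.restrict Ω] g}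
  zero_mem' := ⟨0, differentiableOn_const 0, Lp.coeFn_zero ℂ 2 _⟩
  add_mem' := by
    rintro f₁ f₂ ⟨g₁, h₁, e₁⟩ ⟨g₂, h₂, e₂⟩
    exact ⟨g₁ + g₂, h₁.add h₂, (Lp.coeFn_add f₁ f₂).trans (e₁.add e₂)⟩
  smul_mem' := by
    rintro c f ⟨g, h, e⟩
    exact ⟨c • g, h.const_smul c, (Lp.coeFn_smul c f).trans (e.const_smul c)⟩

theorem measurePreserving_circle_smul {u : ℂ} (hu : ‖u‖ = 1) :
    MeasurePreserving (fun w : ℂ × ℂ => u • w) volume volume := by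
  have h1 : MeasurePreserving (fun w : ℂ => u * w) volume volume := by
    have hu' : u ∈ Submonoid.unitSphere ℂ := by simp [Submonoid.unitSphere, hu]
    exact (rotation ⟨u, hu'⟩).measurePreserving
  exact h1.prod h1

theorem enorm_mul_volume_ball_le {g : ℂ × ℂ → ℂ} {z : ℂ × ℂ} {r : ℝ}
    (hg : DifferentiableOn ℂ g (ball z r)) :
    ‖g z‖ₑ * volume (ball (0 : ℂ × ℂ) r) ≤ ∫⁻ w in ball z r, ‖g w‖ₑ := by
  classical
  set G : ℂ × ℂ → ℂ := (ball z r).piecewise g 0 with hG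
  have hGm : Measurable G :=
    hg.continuousOn.measurable_piecewise continuousOn_const measurableSet_ball
  have hpos : (0 : ℝ) < 2 * Real.pi := by positivity
  have key : ∀ w ∈ ball (0 : ℂ × ℂ) r,
      ‖g z‖ₑ * ENNReal.ofReal (2 * Real.pi) ≤
        ∫⁻ θ in Set.Ioc 0 (2 * Real.pi), ‖G (z + circleMap 0 1 θ • w)‖ₑ := by
    intro w hw
    have hw' : ‖w‖ < r := by simpa using hw
    have hmem : ∀ c : ℂ, ‖c‖ ≤ 1 → z + c • w ∈ ball z r := by
      intro c hc
      simp only [mem_ball, dist_self_add_left, norm_smul]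
      nlinarith [norm_nonneg w]
    have hd : DifferentiableOn ℂ (fun c : ℂ => g (z + c • w)) (closedBall 0 1) := by
      refine hg.comp (by fun_prop) ?_
      intro c hc
      exact hmem c (by simpa using hc)
    have hc : DiffContOnCl ℂ (fun c : ℂ => g (z + c • w)) (ball 0 |1|) := by
      apply DifferentiableOn.diffContOnCl
      rw [abs_one, closure_ball _ one_ne_zero]
      exact hd
    have h1 := hc.circleAverage
    rw [Real.circleAverage_def] at h1
    simp only [zero_smul, add_zero] at h1
    have h2 : g z * ((2 * Real.pi : ℝ) : ℂ) =
        ∫ θ in Set.Ioc 0 (2 * Real.pi), G (z + circleMap 0 1 θ • w) := by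
      rw [← h1, intervalIntegral.integral_of_le hpos.le]
      rw [Complex.real_smul]
      have : (((2 * Real.pi)⁻¹ : ℝ) : ℂ) * ((2 * Real.pi : ℝ) : ℂ) = 1 := by
        rw [← Complex.ofReal_mul, inv_mul_cancel₀ hpos.ne', Complex.ofReal_one]
      rw [mul_right_comm, this, one_mul]
      congr 1
      ext θ
      rw [hG, Set.piecewise_eq_of_mem]
      exact hmem _ (by simp)
    calc ‖g z‖ₑ * ENNReal.ofReal (2 * Real.pi)
        = ‖g z * ((2 * Real.pi : ℝ) : ℂ)‖ₑ := by
          rw [enorm_mul, ← ofReal_norm ((2 * Real.pi : ℝ) : ℂ),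
            Complex.norm_of_nonneg hpos.le]
      _ ≤ _ := by rw [h2]; exact enorm_integral_le_lintegral_enorm _
  have hmeas : Measurable (fun p : (ℂ × ℂ) × ℝ => ‖G (z + circleMap 0 1 p.2 • p.1)‖ₑ) := by
    refine (hGm.comp ?_).enorm
    have : Continuous (fun p : (ℂ × ℂ) × ℝ => z + circleMap 0 1 p.2 • p.1) := by
      have := continuous_circleMap (0 : ℂ) 1
      fun_prop
    exact this.measurable
  have inner : ∀ θ : ℝ, ∫⁻ w in ball (0 : ℂ × ℂ) r, ‖G (z + circleMap 0 1 θ • w)‖ₑ =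
      ∫⁻ w in ball z r, ‖g w‖ₑ := by
    intro θ
    have hu : ‖circleMap 0 1 θ‖ = 1 := by simp
    have mp : MeasurePreserving (fun w : ℂ × ℂ => z + circleMap 0 1 θ • w) volume volume :=
      ((measurePreserving_add_left (volume : Measure ℂ) z.1).prod
        (measurePreserving_add_left (volume : Measure ℂ) z.2)).comp (measurePreserving_circle_smul hu)
    have hpre : (fun w : ℂ × ℂ => z + circleMap 0 1 θ • w) ⁻¹' ball z r = ball 0 r := by
      ext w
      simp [norm_smul]
    have h3 := mp.setLIntegral_comp_preimage (measurableSet_ball (x := z) (ε := r)) hGm.enorm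
    rw [hpre] at h3
    rw [h3]
    refine setLIntegral_congr_fun measurableSet_ball ?_
    intro w hw
    simp only [hG]
    rw [Set.piecewise_eq_of_mem _ _ _ hw]
  have h4 : ‖g z‖ₑ * ENNReal.ofReal (2 * Real.pi) * volume (ball (0 : ℂ × ℂ) r) ≤
      (∫⁻ w in ball z r, ‖g w‖ₑ) * ENNReal.ofReal (2 * Real.pi) := by
    calc _ = ∫⁻ _ in ball (0 : ℂ × ℂ) r, ‖g z‖ₑ * ENNReal.ofReal (2 * Real.pi) := by simp
      _ ≤ ∫⁻ w in ball (0 : ℂ × ℂ) r,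
            ∫⁻ θ in Set.Ioc 0 (2 * Real.pi), ‖G (z + circleMap 0 1 θ • w)‖ₑ :=
          setLIntegral_mono' measurableSet_ball key
      _ = ∫⁻ θ in Set.Ioc 0 (2 * Real.pi),
            ∫⁻ w in ball (0 : ℂ × ℂ) r, ‖G (z + circleMap 0 1 θ • w)‖ₑ :=
          lintegral_lintegral_swap hmeas.aemeasurable
      _ = _ := by simp [inner]
  rw [mul_right_comm] at h4
  exact (ENNReal.mul_le_mul_iff_left (by simpa using hpos) ENNReal.ofReal_ne_top).1 h4

theorem exists_norm_le_of_bergman (Ω : Set (ℂ × ℂ)) {r : ℝ} (hr : 0 < r) :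
    ∃ C : ℝ, 0 ≤ C ∧ ∀ (f : Lp ℂ 2 (volume.restrict Ω)) (g : ℂ × ℂ → ℂ),
      DifferentiableOn ℂ g Ω → f =ᵐ[volume.restrict Ω] g →
        ∀ z, ball z r ⊆ Ω → ‖g z‖ ≤ C * ‖f‖ := by
  set V : ℝ≥0∞ := volume (ball (0 : ℂ × ℂ) r) with hV
  have hV0 : V ≠ 0 := (measure_ball_pos volume _ hr).ne'
  have hVt : V ≠ ∞ := measure_ball_lt_top.ne
  refine ⟨Real.sqrt (V.toReal)⁻¹, Real.sqrt_nonneg _, ?_⟩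
  intro f g hg hfg z hz
  have h1 := enorm_mul_volume_ball_le (g := fun w => g w ^ 2) ((hg.mono hz).pow 2)
  have h2 : ∫⁻ w in ball z r, ‖g w ^ 2‖ₑ ≤ ‖f‖ₑ ^ 2 := by
    calc ∫⁻ w in ball z r, ‖g w ^ 2‖ₑ ≤ ∫⁻ w in Ω, ‖g w ^ 2‖ₑ := lintegral_mono_set hz
      _ = ∫⁻ w in Ω, ‖f w‖ₑ ^ 2 := by
          refine lintegral_congr_ae ?_
          filter_upwards [hfg] with w hw
          rw [hw, enorm_pow]
      _ = ‖f‖ₑ ^ 2 := by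
          rw [Lp.enorm_def, eLpNorm_eq_lintegral_rpow_enorm_toReal two_ne_zero ENNReal.ofNat_ne_top,
            ← ENNReal.rpow_natCast, ← ENNReal.rpow_mul]
          simp
  have h3 : ‖g z‖ ^ 2 * V.toReal ≤ ‖f‖ ^ 2 := by
    have h := h1.trans h2
    rw [enorm_pow] at h
    have := ENNReal.toReal_mono (by finiteness) h
    simpa [ENNReal.toReal_mul, ENNReal.toReal_pow] using this
  have hVp : 0 < V.toReal := ENNReal.toReal_pos hV0 hVt
  rw [← Real.sqrt_sq (norm_nonneg f), ← Real.sqrt_mul (by positivity)]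
  refine Real.le_sqrt_of_sq_le ?_
  rw [inv_mul_eq_div, le_div_iff₀ hVp]
  exact h3

/-- `A²(Ω)` is closed in `L²(Ω)`, so that the orthogonal projection onto it exists. -/
theorem isClosed_bergmanSpace {Ω : Set (ℂ × ℂ)} (hΩ : IsOpen Ω) :
    IsClosed (bergmanSpace Ω : Set (Lp ℂ 2 (volume.restrict Ω))) := by
  refine IsSeqClosed.isClosed ?_
  intro F f hF hlim
  choose g hg hFg using hF
  have hcau : CauchySeq F := hlim.cauchySeq
  have hsub : ∀ n m, (F n - F m : Lp ℂ 2 (volume.restrict Ω)) =ᵐ[volume.restrict Ω] g n - g m :=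
    fun n m => (Lp.coeFn_sub _ _).trans ((hFg n).sub (hFg m))
  -- uniform estimate near each point of the domain
  have key : ∀ z₀ ∈ Ω, ∃ r > 0, ∃ C : ℝ, 0 ≤ C ∧ ball z₀ r ⊆ Ω ∧ ∀ n m, ∀ z ∈ ball z₀ r,
      ‖g n z - g m z‖ ≤ C * ‖F n - F m‖ ∧
        ‖fderiv ℂ (g n) z - fderiv ℂ (g m) z‖ ≤ C * ‖F n - F m‖ := by
    intro z₀ hz₀
    obtain ⟨R, hR, hRΩ⟩ := Metric.isOpen_iff.1 hΩ z₀ hz₀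
    have hr : 0 < R / 3 := by positivity
    obtain ⟨C, hC, hbd⟩ := exists_norm_le_of_bergman Ω hr
    have hb : ∀ n m, ∀ z ∈ ball z₀ (2 * (R / 3)), ‖g n z - g m z‖ ≤ C * ‖F n - F m‖ := by
      intro n m z hz
      refine hbd _ _ ((hg n).sub (hg m)) (hsub n m) z ?_
      refine (ball_subset_ball' ?_).trans hRΩ
      have := mem_ball.1 hz
      linarith
    refine ⟨R / 3, hr, max C (2 * C / (R / 3)), le_max_of_le_left hC,
      (ball_subset_ball (by linarith)).trans hRΩ, ?_⟩
    intro n m z hz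
    have hz' : ball z (R / 3) ⊆ ball z₀ (2 * (R / 3)) :=
      ball_subset_ball' (by have := mem_ball.1 hz; linarith)
    have hzΩ : ball z (R / 3) ⊆ Ω :=
      hz'.trans ((ball_subset_ball (by linarith)).trans hRΩ)
    refine ⟨(hb n m z (hz' (mem_ball_self hr))).trans (by gcongr; exact le_max_left _ _), ?_⟩
    have hdn : ∀ k, DifferentiableAt ℂ (g k) z := fun k =>
      (hg k).differentiableAt (hΩ.mem_nhds (hzΩ (mem_ball_self hr)))
    rw [← fderiv_sub (hdn n) (hdn m)]
    have h := Complex.norm_fderiv_le_div_of_mapsTo_ball (f := g n - g m) (c := z) (R₁ := R / 3)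
      (R₂ := 2 * C * ‖F n - F m‖) (((hg n).sub (hg m)).mono hzΩ) ?_ hr
    · refine h.trans ?_
      rw [mul_div_right_comm]
      gcongr
      exact le_max_right _ _
    · intro w hw
      rw [mem_closedBall, dist_eq_norm]
      refine (norm_sub_le _ _).trans ?_
      have h1 := hb n m w (hz' hw)
      have h2 := hb n m z (hz' (mem_ball_self hr))
      simp only [Pi.sub_apply]
      linarith
  have small : ∀ (C : ℝ), 0 ≤ C → ∀ ε > 0, ∃ N, ∀ m ≥ N, ∀ n ≥ N, C * ‖F m - F n‖ < ε := by
    intro C hC ε hε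
    obtain ⟨N, hN⟩ := Metric.cauchySeq_iff.1 hcau (ε / (C + 1)) (by positivity)
    refine ⟨N, fun m hm n hn => ?_⟩
    have h := hN m hm n hn
    rw [dist_eq_norm, lt_div_iff₀ (by positivity)] at h
    nlinarith [norm_nonneg (F m - F n)]
  have lim0 : ∀ z ∈ Ω, ∃ a, Tendsto (fun n => g n z) atTop (𝓝 a) := by
    intro z hz
    obtain ⟨r, hr, C, hC, -, hb⟩ := key z hz
    refine cauchySeq_tendsto_of_complete (Metric.cauchySeq_iff.2 fun ε hε => ?_)
    obtain ⟨N, hN⟩ := small C hC ε hε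
    exact ⟨N, fun m hm n hn => by
      rw [dist_eq_norm]; exact (hb m n z (mem_ball_self hr)).1.trans_lt (hN m hm n hn)⟩
  have lim1 : ∀ z ∈ Ω, ∃ a, Tendsto (fun n => fderiv ℂ (g n) z) atTop (𝓝 a) := by
    intro z hz
    obtain ⟨r, hr, C, hC, -, hb⟩ := key z hz
    refine cauchySeq_tendsto_of_complete (Metric.cauchySeq_iff.2 fun ε hε => ?_)
    obtain ⟨N, hN⟩ := small C hC ε hε
    exact ⟨N, fun m hm n hn => by
      rw [dist_eq_norm]; exact (hb m n z (mem_ball_self hr)).2.trans_lt (hN m hm n hn)⟩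
  choose! G hG using lim0
  choose! G' hG' using lim1
  refine ⟨G, fun z hz => ?_, ?_⟩
  · obtain ⟨r, hr, C, hC, hrΩ, hb⟩ := key z hz
    have hu : TendstoUniformlyOn (fun n => fderiv ℂ (g n)) G' atTop (ball z r) := by
      refine UniformCauchySeqOn.tendstoUniformlyOn_of_tendsto ?_ fun w hw => hG' w (hrΩ hw)
      refine Metric.uniformCauchySeqOn_iff.2 fun ε hε => ?_
      obtain ⟨N, hN⟩ := small C hC ε hε
      exact ⟨N, fun m hm n hn w hw => by
        rw [dist_eq_norm]; exact (hb m n w hw).2.trans_lt (hN m hm n hn)⟩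
    exact (hasFDerivAt_of_tendstoUniformlyOn isOpen_ball hu
      (fun n w hw => ((hg n).differentiableAt (hΩ.mem_nhds (hrΩ hw))).hasFDerivAt)
      (fun w hw => hG w (hrΩ hw))
      (mem_ball_self hr)).differentiableAt.differentiableWithinAt
  · obtain ⟨φ, hφ, hae⟩ := (tendstoInMeasure_of_tendsto_Lp hlim).exists_seq_tendsto_ae
    have hall : ∀ᵐ z ∂volume.restrict Ω, ∀ n, F n z = g n z := ae_all_iff.2 hFg
    filter_upwards [hae, hall, ae_restrict_mem hΩ.measurableSet] with z h1 h2 hz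
    refine tendsto_nhds_unique h1 ?_
    simp only [h2]
    exact (hG z hz).comp hφ.tendsto_atTop

/-- The Hartogs triangle `{(z₁, z₂) ∈ ℂ² : |z₁| < |z₂| < 1}`. -/
def hartogsTriangle : Set (ℂ × ℂ) := {z | ‖z.1‖ < ‖z.2‖ ∧ ‖z.2‖ < 1}

theorem isOpen_hartogsTriangle : IsOpen hartogsTriangle :=
  (isOpen_lt continuous_fst.norm continuous_snd.norm).inter
    (isOpen_lt continuous_snd.norm continuous_const)

/-- Lebesgue measure `dV` on the Hartogs triangle. -/
noncomputable abbrev hartogsMeasure : Measure (ℂ × ℂ) := volume.restrict hartogsTriangle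

instance hasOrthogonalProjection_bergmanSpace :
    (bergmanSpace hartogsTriangle).HasOrthogonalProjection :=
  haveI : CompleteSpace (bergmanSpace hartogsTriangle) :=
    (isClosed_bergmanSpace isOpen_hartogsTriangle).completeSpace_coe
  inferInstance

/-- The Bergman projection `P` of the Hartogs triangle `ℍ`: the orthogonal projection from `L²(ℍ)`
onto `A²(ℍ)`, regarded as an operator on `L²(ℍ)`. -/
noncomputable def bergmanProjection : Lp ℂ 2 hartogsMeasure →L[ℂ] Lp ℂ 2 hartogsMeasure :=
  (bergmanSpace hartogsTriangle).starProjection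

/-- `T` is the Bergman projection as a bounded operator on `L^p(ℍ)`: a bounded linear operator on
`L^p(ℍ)` with `T f = P f` for every `f ∈ L²(ℍ) ∩ L^p(ℍ)`. As `L²(ℍ) ∩ L^p(ℍ)` is dense in `L^p(ℍ)`
for `p < ∞` (and is all of it for `p = ∞`), there is at most one such `T`, and `‖T‖` is the norm of
`P` on `L^p(ℍ)`. -/
def IsBergmanProjectionOnLp (p : ℝ≥0∞) [Fact (1 ≤ p)]
    (T : Lp ℂ p hartogsMeasure →L[ℂ] Lp ℂ p hartogsMeasure) : Prop :=
  ∀ (f : Lp ℂ 2 hartogsMeasure) (g : Lp ℂ p hartogsMeasure),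
    f =ᵐ[hartogsMeasure] g → T g =ᵐ[hartogsMeasure] bergmanProjection f

/-- The function `|z₂|^{-q} z̄₂`. -/
noncomputable def hartogsTestFunction (q : ℝ) (z : ℂ × ℂ) : ℂ :=
  ((‖z.2‖ ^ (-q) : ℝ) : ℂ) * (starRingEnd ℂ) z.2

/-! The map `(u, w) ↦ (u w, w)` carries the disc times the punctured disc onto the Hartogs triangle
with Jacobian `|w|²`, so `f ↦ w f(u w, w)` is an `L²` isometry onto the bidisc that preserves
holomorphy. A square-integrable holomorphic function on the punctured disc extends over the origin,
so the kernel of `P` is the bidisc kernel pulled back: with `x = z₂ w̄₂` it is `π⁻² x⁻¹ (1 - x)⁻²`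
times `(1 - u v̄)⁻²`, where `u = z₁ / z₂` and `v = w₁ / w₂` (`integral_hartogsKernel_mul_of_mem`,
`bergmanProjection_ae_eq`).

Upper bound: `x⁻¹ (1 - x)⁻² = x⁻¹ + (2 - x)(1 - x)⁻²` splits the kernel (`enorm_hartogsKernel_le`).
The second term is dominated by a product of disc kernels, bounded on `L^p` uniformly for `4/3 < p <
4` by Schur's test and the Forelli–Rudin estimate. The first is of rank one in the second variable
and costs a constant times `(4 - p)^(-1/p) (4 - q)^(-1/q)`, `q` being the conjugate exponent. As `4
- q = (3p - 4)/(p - 1)` with `1/3 < p - 1 < 3`, this is the claimed quantity up to constants, and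
that quantity is bounded below, so it absorbs the uniform term.

Lower bound: `P` sends `φ(|z₂|) z̄₂` to a constant multiple of `1/z₂` (`hartogsIntegral_radial`).
The function `|z₂|^(-q) z̄₂` is the Hölder extremal for pairing with `1/z₂`, and both of its norms
can be computed exactly.

Failure: `P z̄₂ = 1/(2 z₂)` is not in `L^p` for `p ≥ 4`. For `p ≤ 4/3`, truncating `|z₂|⁻⁴ z̄₂` to
`|z₂| > ε` gives `L^(4/3)` norms of order `(log 1/ε)^(3/4)`, while the images are `2 log(1/ε) / z₂`.
-/

/-! ### Polar coordinates on the unit disc. -/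

open Real in
theorem lintegral_unitDisc_polar {f : ℂ → ℝ≥0∞} (hf : Measurable f) :
    ∫⁻ z in ball (0 : ℂ) 1, f z =
      ∫⁻ r in Set.Ioo (0 : ℝ) 1, ENNReal.ofReal r * ∫⁻ θ in Set.Ioo (-π) π, f (circleMap 0 r θ) := by
  rw [← lintegral_indicator measurableSet_ball, ← Complex.lintegral_comp_polarCoord_symm]
  have hcm : Measurable (fun p : ℝ × ℝ => circleMap 0 p.1 p.2) := by
    unfold circleMap; fun_prop
  have h1 : ∀ p ∈ polarCoord.target, ENNReal.ofReal p.1 •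
      (ball (0 : ℂ) 1).indicator f (Complex.polarCoord.symm p) =
      (Set.Iio (1 : ℝ) ×ˢ Set.univ).indicator
        (fun p => ENNReal.ofReal p.1 * f (circleMap 0 p.1 p.2)) p := by
    rintro ⟨r, θ⟩ hp
    simp only [polarCoord_target, Set.mem_prod, Set.mem_Ioi] at hp
    have h2 : Complex.polarCoord.symm (r, θ) = circleMap 0 r θ := by
      simp [Complex.polarCoord_symm_apply, circleMap, Complex.exp_mul_I]
    have h3 : circleMap 0 r θ ∈ ball (0 : ℂ) 1 ↔ r < 1 := by simp [abs_of_pos hp.1]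
    simp only [h2, Set.indicator, h3, Set.mem_prod, Set.mem_Iio, Set.mem_univ, and_true,
      smul_eq_mul]
    split_ifs <;> simp
  rw [setLIntegral_congr_fun polarCoord.open_target.measurableSet h1, polarCoord_target,
    setLIntegral_indicator (measurableSet_Iio.prod MeasurableSet.univ), Set.prod_inter_prod,
    Set.univ_inter, Set.Iio_inter_Ioi, Measure.volume_eq_prod, ← Measure.prod_restrict,
    lintegral_prod _ (by
      exact (measurable_fst.ennreal_ofReal.mul (hf.comp hcm)).aemeasurable)]
  refine lintegral_congr fun r => ?_
  have hr : Measurable fun θ => f (circleMap 0 r θ) :=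
    hf.comp (continuous_circleMap 0 r).measurable
  simp only
  rw [lintegral_const_mul _ hr]

theorem setIntegral_Ioo_circleMap (f : ℂ → ℂ) (r : ℝ) :
    ∫ θ in Set.Ioo (-Real.pi) Real.pi, f (circleMap 0 r θ) =
      (2 * Real.pi) * Real.circleAverage f 0 r := by
  rw [← integral_Ioc_eq_integral_Ioo, ← intervalIntegral.integral_of_le (by linarith [Real.pi_pos])]
  have h : Function.Periodic (fun θ => f (circleMap 0 r θ)) (2 * Real.pi) := fun θ => by
    simp only [periodic_circleMap (0 : ℂ) r θ]
  have h2 := h.intervalIntegral_add_eq (-Real.pi) 0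
  rw [show -Real.pi + 2 * Real.pi = Real.pi by ring, zero_add] at h2
  rw [h2, Real.circleAverage_def, Complex.real_smul]
  have := Real.pi_ne_zero
  push_cast
  field_simp

open Real in
theorem integral_unitDisc_polar {f : ℂ → ℂ} (hf : Measurable f) (hi : IntegrableOn f (ball 0 1)) :
    ∫ z in ball (0 : ℂ) 1, f z =
      ∫ r in Set.Ioo (0 : ℝ) 1, (r : ℂ) * ((2 * π) * Real.circleAverage f 0 r) := by
  have hcm : Measurable (fun p : ℝ × ℝ => circleMap 0 p.1 p.2) := by
    unfold circleMap; fun_prop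
  rw [← integral_indicator measurableSet_ball, ← Complex.integral_comp_polarCoord_symm]
  have h1 : ∀ p ∈ polarCoord.target, p.1 •
      (ball (0 : ℂ) 1).indicator f (Complex.polarCoord.symm p) =
      (Set.Iio (1 : ℝ) ×ˢ Set.univ).indicator
        (fun p => (p.1 : ℂ) * f (circleMap 0 p.1 p.2)) p := by
    rintro ⟨r, θ⟩ hp
    simp only [polarCoord_target, Set.mem_prod, Set.mem_Ioi] at hp
    have h2 : Complex.polarCoord.symm (r, θ) = circleMap 0 r θ := by
      simp [Complex.polarCoord_symm_apply, circleMap, Complex.exp_mul_I]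
    have h3 : circleMap 0 r θ ∈ ball (0 : ℂ) 1 ↔ r < 1 := by simp [abs_of_pos hp.1]
    simp only [h2, Set.indicator, h3, Set.mem_prod, Set.mem_Iio, Set.mem_univ, and_true,
      Complex.real_smul]
    split_ifs <;> simp
  have hm : Measurable (fun p : ℝ × ℝ => (p.1 : ℂ) * f (circleMap 0 p.1 p.2)) := by fun_prop
  have hint : Integrable (fun p : ℝ × ℝ => (p.1 : ℂ) * f (circleMap 0 p.1 p.2))
      ((volume.restrict (Set.Ioo 0 1)).prod (volume.restrict (Set.Ioo (-π) π))) := by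
    refine ⟨hm.aestronglyMeasurable, ?_⟩
    -- Fubini needs integrability in polar coordinates; it comes from the nonnegative version
    -- applied to the norm.
    have h2 := hi.2
    rw [hasFiniteIntegral_iff_enorm, lintegral_unitDisc_polar hf.enorm] at h2
    rw [hasFiniteIntegral_iff_enorm, lintegral_prod _ hm.enorm.aemeasurable]
    refine lt_of_le_of_lt (le_of_eq ?_) h2
    refine setLIntegral_congr_fun measurableSet_Ioo fun r hr => ?_
    simp only [enorm_mul]
    rw [lintegral_const_mul _ (by fun_prop), ← ofReal_norm (r : ℂ),
      Complex.norm_of_nonneg hr.1.le]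
  rw [setIntegral_congr_fun polarCoord.open_target.measurableSet h1, polarCoord_target,
    setIntegral_indicator (measurableSet_Iio.prod MeasurableSet.univ), Set.prod_inter_prod,
    Set.inter_univ, Set.Ioi_inter_Iio, Measure.volume_eq_prod, ← Measure.prod_restrict,
    integral_prod _ hint]
  refine integral_congr_ae (Eventually.of_forall fun r => ?_)
  simp only
  rw [integral_const_mul, setIntegral_Ioo_circleMap]

theorem lintegral_unitDisc_norm {φ : ℝ → ℝ≥0∞} (hφ : Measurable φ) :
    ∫⁻ z in ball (0 : ℂ) 1, φ ‖z‖ =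
      ENNReal.ofReal (2 * Real.pi) * ∫⁻ r in Set.Ioo (0 : ℝ) 1, ENNReal.ofReal r * φ r := by
  rw [lintegral_unitDisc_polar (f := fun z => φ ‖z‖) (hφ.comp measurable_norm),
    ← lintegral_const_mul _ (by fun_prop)]
  refine setLIntegral_congr_fun measurableSet_Ioo fun r hr => ?_
  simp only [norm_circleMap_zero, abs_of_pos hr.1, lintegral_const,
    Measure.restrict_apply_univ, Real.volume_Ioo]
  rw [show Real.pi - -Real.pi = 2 * Real.pi by ring]
  ring

/-! ### The Forelli–Rudin estimate on the disc. -/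

theorem norm_mul_lt_one {u v : ℂ} (hu : ‖u‖ < 1) (hv : ‖v‖ < 1) : ‖u * v‖ < 1 := by
  rw [norm_mul]; nlinarith [norm_nonneg u, norm_nonneg v]

theorem one_sub_ne_zero_of_norm_lt {x : ℂ} (hx : ‖x‖ < 1) : 1 - x ≠ 0 := by
  intro h
  rw [← sub_eq_zero.1 h] at hx
  simp at hx

theorem norm_mul_conj_lt_one {u v : ℂ} (hu : ‖u‖ < 1) (hv : ‖v‖ < 1) :
    ‖u * (starRingEnd ℂ) v‖ < 1 :=
  norm_mul_lt_one hu (by rwa [RCLike.norm_conj])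

theorem circleAverage_eq_center_of_differentiableOn {f : ℂ → ℂ} {r : ℝ}
    (hf : DifferentiableOn ℂ f (closedBall 0 |r|)) : Real.circleAverage f 0 r = f 0 := by
  rcases eq_or_ne r 0 with rfl | hr
  · simp
  · exact (DifferentiableOn.diffContOnCl
      (by rwa [closure_ball _ (abs_ne_zero.2 hr)])).circleAverage

/-- The real part of `(1 + aζ)/(1 - aζ)` is `(1 - |aζ|²)/|1 - aζ|²`, a Poisson kernel, and its mean
over the circle is its value `1` at the centre. -/
theorem circleAverage_inv_norm_sq {u : ℂ} (hu : ‖u‖ < 1) {r : ℝ} (hr0 : 0 ≤ r) (hr : r < 1) :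
    Real.circleAverage (fun ζ => ((‖1 - u * (starRingEnd ℂ) ζ‖ ^ 2)⁻¹ : ℝ)) 0 r =
      (1 - ‖u‖ ^ 2 * r ^ 2)⁻¹ := by
  set a : ℂ := (starRingEnd ℂ) u with ha
  have ha1 : ‖a‖ < 1 := by rwa [ha, RCLike.norm_conj]
  have hden : ∀ ζ ∈ closedBall (0 : ℂ) |r|, 1 - a * ζ ≠ 0 := fun ζ hζ => by
    refine one_sub_ne_zero_of_norm_lt (norm_mul_lt_one ha1 ?_)
    rw [mem_closedBall_zero_iff, abs_of_nonneg hr0] at hζ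
    linarith
  have hd : DifferentiableOn ℂ (fun ζ => (1 + a * ζ) / (1 - a * ζ)) (closedBall 0 |r|) :=
    DifferentiableOn.div (by fun_prop) (by fun_prop) hden
  have h1 := circleAverage_eq_center_of_differentiableOn hd
  have hci : CircleIntegrable (fun ζ => (1 + a * ζ) / (1 - a * ζ)) 0 r := by
    refine ContinuousOn.circleIntegrable' ?_
    exact hd.continuousOn.mono sphere_subset_closedBall
  have h2 := congrArg Complex.reCLM h1
  have hpos : 0 < 1 - ‖u‖ ^ 2 * r ^ 2 := by
    have : ‖u‖ * r < 1 := by nlinarith [norm_nonneg u]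
    have h0 : 0 ≤ ‖u‖ * r := by positivity
    nlinarith
  have h3 : Complex.reCLM (Real.circleAverage (fun ζ => (1 + a * ζ) / (1 - a * ζ)) 0 r) =
      Real.circleAverage (fun ζ => (1 - ‖u‖ ^ 2 * r ^ 2) •
        ((‖1 - u * (starRingEnd ℂ) ζ‖ ^ 2)⁻¹ : ℝ)) 0 r := by
    rw [Real.circleAverage_def, Real.circleAverage_def, map_smul,
      ← ContinuousLinearMap.intervalIntegral_comp_comm _ hci]
    congr 1
    refine intervalIntegral.integral_congr fun θ _ => ?_
    set ζ := circleMap 0 r θ with hζ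
    have hζn : ‖ζ‖ = r := by simp [hζ, abs_of_nonneg hr0]
    have e1 : ‖1 - u * (starRingEnd ℂ) ζ‖ = ‖1 - a * ζ‖ := by
      rw [← RCLike.norm_conj]; simp [ha]
    have hz : 1 - a * ζ ≠ 0 := hden ζ (by simp [hζn, abs_of_nonneg hr0])
    simp only [Complex.reCLM_apply, smul_eq_mul]
    rw [e1, Complex.div_re, ← Complex.normSq_eq_norm_sq (1 - a * ζ)]
    have e2 : ‖u‖ ^ 2 * r ^ 2 = Complex.normSq (a * ζ) := by
      rw [Complex.normSq_eq_norm_sq, norm_mul, hζn, ha, RCLike.norm_conj, mul_pow]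
    rw [e2, ← add_div, div_eq_mul_inv]
    congr 1
    simp [Complex.normSq_apply]
    ring
  rw [h3, Real.circleAverage_fun_smul] at h2
  simp at h2
  exact eq_inv_of_mul_eq_one_right h2

/-- Integrability need not be assumed: it follows from the sign of the derivative and continuity of
`F` up to the endpoints, so integrable endpoint singularities are allowed. -/
theorem lintegral_Ioo_of_hasDerivAt {F f : ℝ → ℝ} {a b : ℝ} (hab : a ≤ b)
    (hF : ContinuousOn F (Set.Icc a b)) (hd : ∀ x ∈ Set.Ioo a b, HasDerivAt F (f x) x)
    (hf : ∀ x ∈ Set.Ioo a b, 0 ≤ f x) :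
    ∫⁻ x in Set.Ioo a b, ENNReal.ofReal (f x) = ENNReal.ofReal (F b - F a) := by
  have hi := intervalIntegral.integrableOn_deriv_of_nonneg hF hd hf
  have h1 := intervalIntegral.integral_eq_sub_of_hasDerivAt_of_le hab hF hd
    ((intervalIntegrable_iff_integrableOn_Ioc_of_le hab).2 hi)
  rw [← h1, intervalIntegral.integral_of_le hab, integral_Ioc_eq_integral_Ioo]
  rw [ofReal_integral_eq_lintegral_ofReal (hi.mono_set Set.Ioo_subset_Ioc_self)]
  exact (ae_restrict_iff' measurableSet_Ioo).2 (Eventually.of_forall hf)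

theorem lintegral_Ioo_rpow {s : ℝ} (hs : -1 < s) :
    ∫⁻ r in Set.Ioo (0 : ℝ) 1, ENNReal.ofReal (r ^ s) = ENNReal.ofReal (1 / (s + 1)) := by
  have hs' : 0 < s + 1 := by linarith
  rw [lintegral_Ioo_of_hasDerivAt (F := fun x => x ^ (s + 1) / (s + 1)) zero_le_one]
  · simp [Real.zero_rpow hs'.ne']
  · exact ((Real.continuous_rpow_const hs'.le).div_const _).continuousOn
  · intro x hx
    have := (Real.hasDerivAt_rpow_const (p := s + 1) (Or.inl hx.1.ne')).div_const (s + 1)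
    refine this.congr_deriv ?_
    field_simp
    ring_nf
  · intro x hx
    exact Real.rpow_nonneg hx.1.le _

theorem lintegral_Ioo_inv {ε : ℝ} (h0 : 0 < ε) (h1 : ε ≤ 1) :
    ∫⁻ r in Set.Ioo ε 1, ENNReal.ofReal r⁻¹ = ENNReal.ofReal (-Real.log ε) := by
  rw [lintegral_Ioo_of_hasDerivAt (F := Real.log) h1]
  · simp
  · exact Real.continuousOn_log.mono fun x hx => by
      simp only [Set.mem_compl_iff, Set.mem_singleton_iff]
      have := hx.1
      linarith
  · exact fun x hx => Real.hasDerivAt_log (h0.trans hx.1).ne'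
  · exact fun x hx => inv_nonneg.2 (h0.trans hx.1).le

/-- Split at `r = a`. Below it, `1 - a²r² ≥ 1 - r²` and the integrand is dominated by `2r(1 -
r²)^(-t-1)`, giving the `1/t` term; above it, `1 - a²r² ≥ 1 - a²` leaves `2r(1 - r²)^(-t)`, giving
the `1/(1 - t)` term. -/
theorem lintegral_radial_inv_le {a t : ℝ} (ha0 : 0 ≤ a) (ha : a < 1) (ht0 : 0 < t) (ht1 : t < 1) :
    ∫⁻ r in Set.Ioo (0 : ℝ) 1,
        ENNReal.ofReal (2 * r * (1 - r ^ 2) ^ (-t) * (1 - a ^ 2 * r ^ 2)⁻¹) ≤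
      ENNReal.ofReal ((1 / t + 1 / (1 - t)) * (1 - a ^ 2) ^ (-t)) := by
  have hδ : 0 < 1 - a ^ 2 := by nlinarith
  have hsub : Set.Ioo (0 : ℝ) 1 ⊆ Set.Ioo 0 a ∪ Set.Ico a 1 := by
    intro r hr
    rcases lt_or_ge r a with h | h
    · exact Or.inl ⟨hr.1, h⟩
    · exact Or.inr ⟨h, hr.2⟩
  have hbase : ∀ r : ℝ, HasDerivAt (fun r : ℝ => 1 - r ^ 2) (-(2 * r)) r := fun r => by
    simpa using ((hasDerivAt_id r).pow 2).const_sub 1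
  have hpos : ∀ r : ℝ, 0 ≤ r → r < 1 → 0 < 1 - r ^ 2 := fun r h0 h1 => by nlinarith
  have hA : ∫⁻ r in Set.Ioo 0 a,
      ENNReal.ofReal (2 * r * (1 - r ^ 2) ^ (-t) * (1 - a ^ 2 * r ^ 2)⁻¹) ≤
      ENNReal.ofReal (1 / t * (1 - a ^ 2) ^ (-t)) := by
    calc _ ≤ ∫⁻ r in Set.Ioo 0 a, ENNReal.ofReal (2 * r * (1 - r ^ 2) ^ (-t - 1)) := by
          refine setLIntegral_mono' measurableSet_Ioo fun r hr => ENNReal.ofReal_le_ofReal ?_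
          have hr1 := hpos r hr.1.le (hr.2.trans ha)
          rw [Real.rpow_sub_one hr1.ne', div_eq_mul_inv, ← mul_assoc]
          have := hr.1
          have : 0 ≤ 2 * r * (1 - r ^ 2) ^ (-t) := by positivity
          refine mul_le_mul_of_nonneg_left (inv_anti₀ hr1 ?_) this
          nlinarith [sq_nonneg r]
      _ = ENNReal.ofReal ((1 - a ^ 2) ^ (-t) / t - (1 - (0 : ℝ) ^ 2) ^ (-t) / t) := by
          refine lintegral_Ioo_of_hasDerivAt (F := fun r => (1 - r ^ 2) ^ (-t) / t) ha0 ?_ ?_ ?_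
          · refine ContinuousOn.div_const (ContinuousOn.rpow_const (by fun_prop) ?_) _
            exact fun r hr => Or.inl (hpos r hr.1 (hr.2.trans_lt ha)).ne'
          · intro r hr
            have hr1 := hpos r hr.1.le (hr.2.trans ha)
            refine (((hbase r).rpow_const (p := -t) (Or.inl hr1.ne')).div_const t).congr_deriv ?_
            field_simp
          · intro r hr
            have hr1 := hpos r hr.1.le (hr.2.trans ha)
            have := hr.1
            positivity
      _ ≤ _ := by
          refine ENNReal.ofReal_le_ofReal ?_
          have : 0 ≤ (1 - (0 : ℝ) ^ 2) ^ (-t) / t := by norm_num; exact ht0.le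
          rw [div_mul_eq_mul_div, one_mul]
          linarith
  have hB : ∫⁻ r in Set.Ico a 1,
      ENNReal.ofReal (2 * r * (1 - r ^ 2) ^ (-t) * (1 - a ^ 2 * r ^ 2)⁻¹) ≤
      ENNReal.ofReal (1 / (1 - t) * (1 - a ^ 2) ^ (-t)) := by
    have ht' : 0 < 1 - t := by linarith
    rw [setLIntegral_congr Ioo_ae_eq_Ico.symm]
    calc _ ≤ ∫⁻ r in Set.Ioo a 1,
          ENNReal.ofReal (2 * r * (1 - r ^ 2) ^ (-t) * (1 - a ^ 2)⁻¹) := by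
          refine setLIntegral_mono' measurableSet_Ioo fun r hr => ENNReal.ofReal_le_ofReal ?_
          have hr0 : 0 ≤ r := ha0.trans hr.1.le
          have hr1 := hpos r hr0 hr.2
          have : 0 ≤ 2 * r * (1 - r ^ 2) ^ (-t) := by positivity
          refine mul_le_mul_of_nonneg_left (inv_anti₀ hδ ?_) this
          nlinarith [sq_nonneg a]
      _ = ENNReal.ofReal (-((1 - (1 : ℝ) ^ 2) ^ (1 - t) / (1 - t) * (1 - a ^ 2)⁻¹) -
            -((1 - a ^ 2) ^ (1 - t) / (1 - t) * (1 - a ^ 2)⁻¹)) := by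
          refine lintegral_Ioo_of_hasDerivAt
            (F := fun r => -((1 - r ^ 2) ^ (1 - t) / (1 - t) * (1 - a ^ 2)⁻¹)) ha.le ?_ ?_ ?_
          · refine Continuous.continuousOn ?_
            refine (((Real.continuous_rpow_const ht'.le).comp (by fun_prop)).div_const _
              |>.mul_const _).neg
          · intro r hr
            have hr1 := hpos r (ha0.trans hr.1.le) hr.2
            refine ((((hbase r).rpow_const (p := 1 - t) (Or.inl hr1.ne')).div_const
              (1 - t)).mul_const (1 - a ^ 2)⁻¹).neg.congr_deriv ?_
            rw [show 1 - t - 1 = -t by ring]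
            field_simp
          · intro r hr
            have hr0 : 0 ≤ r := ha0.trans hr.1.le
            have hr1 := hpos r hr0 hr.2
            positivity
      _ ≤ _ := by
          refine ENNReal.ofReal_le_ofReal ?_
          rw [one_pow, sub_self, Real.zero_rpow ht'.ne', show 1 - t = -t + 1 by ring,
            Real.rpow_add_one hδ.ne']
          refine le_of_eq ?_
          field_simp
          ring
  calc _ ≤ _ := lintegral_mono_set hsub
    _ ≤ _ := lintegral_union_le _ _ _
    _ ≤ _ := add_le_add hA hB
    _ = _ := by
      have ht' : 0 < 1 - t := by linarith
      rw [← ENNReal.ofReal_add (by positivity) (by positivity), add_mul]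

theorem measurable_inv_norm_sq_kernel (u : ℂ) :
    Measurable (fun ζ : ℂ => (‖1 - u * (starRingEnd ℂ) ζ‖ ^ 2)⁻¹) := by
  have : Measurable (starRingEnd ℂ) := Complex.continuous_conj.measurable
  fun_prop

/-- The Forelli–Rudin estimate for the Bergman kernel of the disc. -/
theorem lintegral_unitDisc_rpow_mul_kernel_le {u : ℂ} (hu : ‖u‖ < 1) {t : ℝ} (ht0 : 0 < t)
    (ht1 : t < 1) :
    ∫⁻ v in ball (0 : ℂ) 1, ENNReal.ofReal ((1 - ‖v‖ ^ 2) ^ (-t)) *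
        ENNReal.ofReal ((‖1 - u * (starRingEnd ℂ) v‖ ^ 2)⁻¹) ≤
      ENNReal.ofReal (Real.pi * (1 / t + 1 / (1 - t)) * (1 - ‖u‖ ^ 2) ^ (-t)) := by
  have hkm := measurable_inv_norm_sq_kernel u
  have hcm : ∀ r, Measurable (circleMap 0 r) := fun r => (continuous_circleMap 0 r).measurable
  rw [lintegral_unitDisc_polar (by fun_prop), mul_assoc, ENNReal.ofReal_mul Real.pi_pos.le]
  refine le_trans (le_of_eq ?_) (mul_le_mul_right
    (lintegral_radial_inv_le (norm_nonneg u) hu ht0 ht1) _)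
  rw [← lintegral_const_mul _ (by fun_prop)]
  refine setLIntegral_congr_fun measurableSet_Ioo fun r hr => ?_
  simp only [norm_circleMap_zero, abs_of_pos hr.1]
  rw [lintegral_const_mul _ (by fun_prop)]
  have hne : ∀ θ, 1 - u * (starRingEnd ℂ) (circleMap 0 r θ) ≠ 0 := fun θ =>
    one_sub_ne_zero_of_norm_lt (norm_mul_conj_lt_one hu (by simpa [abs_of_pos hr.1] using hr.2))
  have hcont : Continuous fun θ => (‖1 - u * (starRingEnd ℂ) (circleMap 0 r θ)‖ ^ 2)⁻¹ := by
    refine Continuous.inv₀ ?_ fun θ => by simpa using hne θ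
    have := continuous_circleMap 0 r
    have := Complex.continuous_conj
    fun_prop
  have h1 : ∫⁻ θ in Set.Ioo (-Real.pi) Real.pi,
      ENNReal.ofReal ((‖1 - u * (starRingEnd ℂ) (circleMap 0 r θ)‖ ^ 2)⁻¹) =
      ENNReal.ofReal (2 * Real.pi * (1 - ‖u‖ ^ 2 * r ^ 2)⁻¹) := by
    rw [← ofReal_integral_eq_lintegral_ofReal
      (hcont.integrableOn_Icc.mono_set Set.Ioo_subset_Icc_self)
      (Eventually.of_forall fun θ => by positivity)]
    congr 1
    have h2 := setIntegral_Ioo_circleMap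
      (fun ζ => (((‖1 - u * (starRingEnd ℂ) ζ‖ ^ 2)⁻¹ : ℝ) : ℂ)) r
    rw [integral_complex_ofReal] at h2
    rw [← circleAverage_inv_norm_sq hu hr.1.le hr.2]
    have h3 : Real.circleAverage
        (fun ζ => (((‖1 - u * (starRingEnd ℂ) ζ‖ ^ 2)⁻¹ : ℝ) : ℂ)) 0 r =
        ((Real.circleAverage (fun ζ => (‖1 - u * (starRingEnd ℂ) ζ‖ ^ 2)⁻¹) 0 r : ℝ) : ℂ) := by
      rw [Real.circleAverage_def, Real.circleAverage_def, intervalIntegral.integral_ofReal]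
      simp
    rw [h3] at h2
    exact_mod_cast h2
  have hr2 : 0 ≤ 1 - r ^ 2 := by nlinarith [hr.1, hr.2]
  have hr0 := hr.1.le
  rw [h1, ← ENNReal.ofReal_mul (by positivity), ← ENNReal.ofReal_mul hr.1.le,
    ← ENNReal.ofReal_mul Real.pi_pos.le]
  congr 1
  ring

/-! ### The reproducing property on the disc. -/

/-- On `|ζ| = r` one has `ζ̄ = r²/ζ`, so `1 - z ζ̄ = (ζ - z r²)/ζ` and the average becomes Cauchy's
formula for the derivative of `ζ h(ζ)` at `z r²`. -/
theorem circleAverage_mul_kernel {h : ℂ → ℂ} (hd : DifferentiableOn ℂ h (ball 0 1)) {z : ℂ}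
    (hz : ‖z‖ < 1) {r : ℝ} (hr0 : 0 < r) (hr : r < 1) :
    Real.circleAverage (fun ζ => h ζ / (1 - z * (starRingEnd ℂ) ζ) ^ 2) 0 r =
      deriv (fun ζ => ζ * h ζ) (z * r ^ 2) := by
  rw [Real.circleAverage_eq_circleIntegral hr0.ne',
    ← Complex.two_pi_I_inv_smul_circleIntegral_sub_sq_inv_smul_of_differentiable (R := r) (c := 0)
      (U := ball 0 1) (f := fun ζ => ζ * h ζ) isOpen_ball (closedBall_subset_ball hr)
      (by fun_prop)]
  · congr 1
    refine circleIntegral.integral_congr hr0.le fun ζ hζ => ?_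
    have hζn : ‖ζ‖ = r := by simpa using hζ
    have hζ0 : ζ ≠ 0 := by
      rw [← norm_ne_zero_iff, hζn]
      exact hr0.ne'
    have e : ζ * (starRingEnd ℂ) ζ = r ^ 2 := by
      rw [Complex.mul_conj, Complex.normSq_eq_norm_sq, hζn]; push_cast; rfl
    have e2 : 1 - z * (starRingEnd ℂ) ζ = (ζ - z * r ^ 2) / ζ := by
      rw [← e]; field_simp
    have hne : 1 - z * (starRingEnd ℂ) ζ ≠ 0 :=
      one_sub_ne_zero_of_norm_lt (norm_mul_conj_lt_one hz (hζn ▸ hr))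
    rw [e2] at hne
    have hne' : ζ - z * r ^ 2 ≠ 0 := fun h0 => hne (by simp [h0])
    simp only [smul_eq_mul, sub_zero]
    rw [e2]
    field_simp
  · simp only [mem_ball, dist_zero_right, norm_mul, norm_pow, Complex.norm_real, Real.norm_eq_abs,
      abs_of_pos hr0]
    nlinarith [norm_nonneg z, sq_nonneg r]

theorem norm_kernel_inv_le {z w : ℂ} (hz : ‖z‖ < 1) (hw : ‖w‖ < 1) :
    ‖((1 - z * (starRingEnd ℂ) w) ^ 2)⁻¹‖ ≤ ((1 - ‖z‖) ^ 2)⁻¹ := by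
  rw [norm_inv, norm_pow]
  have h1 : 1 - ‖z‖ ≤ ‖1 - z * (starRingEnd ℂ) w‖ := by
    have := norm_sub_norm_le 1 (z * (starRingEnd ℂ) w)
    rw [norm_mul, RCLike.norm_conj, norm_one] at this
    nlinarith [norm_nonneg z]
  have h0 : 0 < 1 - ‖z‖ := by linarith
  gcongr

theorem measurable_kernel_inv (z : ℂ) :
    Measurable fun w : ℂ => ((1 - z * (starRingEnd ℂ) w) ^ 2)⁻¹ := by
  have : Measurable (starRingEnd ℂ) := Complex.continuous_conj.measurable
  fun_prop

theorem integrableOn_div_kernel {h : ℂ → ℂ} (hi : IntegrableOn h (ball 0 1)) {z : ℂ}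
    (hz : ‖z‖ < 1) :
    IntegrableOn (fun w => h w / (1 - z * (starRingEnd ℂ) w) ^ 2) (ball 0 1) := by
  simp only [div_eq_mul_inv]
  refine Integrable.mul_bdd (c := ((1 - ‖z‖) ^ 2)⁻¹) hi (measurable_kernel_inv z).aestronglyMeasurable ?_
  filter_upwards [ae_restrict_mem measurableSet_ball] with w hw
  exact norm_kernel_inv_le hz (by simpa using hw)

/-- The antiderivative is `π F(z r²)/z` for `F(ζ) = ζ h(ζ)`, written without division so that `z =
0` is allowed. Its increment over `[0, 1]` is `π h(z)`, which is the reproducing formula. -/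
theorem hasDerivAt_mul_kernel_antideriv {h : ℂ → ℂ} (hd : DifferentiableOn ℂ h (ball 0 1))
    {z : ℂ} (hz : ‖z‖ < 1) {r : ℝ} (hr : r ∈ Set.Icc (0 : ℝ) 1) :
    HasDerivAt (fun r : ℝ => Real.pi * (r : ℂ) ^ 2 * h (z * r ^ 2))
      ((r : ℂ) * ((2 * Real.pi) * deriv (fun ζ => ζ * h ζ) (z * r ^ 2))) r := by
  have hmem : z * (r : ℂ) ^ 2 ∈ ball (0 : ℂ) 1 := by
    simp only [mem_ball, dist_zero_right, norm_mul, norm_pow, Complex.norm_real, Real.norm_eq_abs,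
      abs_of_nonneg hr.1]
    nlinarith [norm_nonneg z, pow_le_one₀ hr.1 hr.2 (n := 2)]
  have hh := (hd.differentiableAt (isOpen_ball.mem_nhds hmem)).hasDerivAt
  have h1 : deriv (fun ζ => ζ * h ζ) (z * r ^ 2) =
      h (z * r ^ 2) + z * r ^ 2 * deriv h (z * r ^ 2) := by
    have := ((hasDerivAt_id' _).mul hh).deriv
    rw [one_mul] at this
    exact this
  have hr1 : HasDerivAt (fun r : ℝ => (r : ℂ) ^ 2) (2 * (r : ℂ)) r := by
    have := ((hasDerivAt_id (r : ℂ)).pow 2).comp_ofReal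
    simpa using this
  have h2 := (hr1.const_mul (Real.pi : ℂ)).mul (hh.comp r (hr1.const_mul z))
  refine h2.congr_deriv ?_
  rw [h1]
  simp only [Function.comp]
  ring

/-- The reproducing property of the Bergman kernel of the unit disc. -/
theorem integral_unitDisc_reproducing {h : ℂ → ℂ} (hd : DifferentiableOn ℂ h (ball 0 1))
    (hi : IntegrableOn h (ball 0 1)) {z : ℂ} (hz : ‖z‖ < 1) :
    ∫ w in ball (0 : ℂ) 1, h w / (1 - z * (starRingEnd ℂ) w) ^ 2 = Real.pi * h z := by
  classical
  -- The polar formula asks for a globally measurable function, so `h` is replaced by zero off the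
  -- disc.
  set h' : ℂ → ℂ := (ball (0 : ℂ) 1).piecewise h 0 with hh'
  have hm : Measurable h' :=
    hd.continuousOn.measurable_piecewise continuousOn_const measurableSet_ball
  have heq : Set.EqOn h h' (ball 0 1) := fun w hw => by rw [hh', Set.piecewise_eq_of_mem _ _ _ hw]
  have hi' : IntegrableOn h' (ball 0 1) := hi.congr_fun heq measurableSet_ball
  rw [setIntegral_congr_fun (g := fun w => h' w / (1 - z * (starRingEnd ℂ) w) ^ 2)
    measurableSet_ball fun w hw => by simp only [heq hw]]
  have hm2 : Measurable fun w => h' w / (1 - z * (starRingEnd ℂ) w) ^ 2 := by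
    simp only [div_eq_mul_inv]
    exact hm.mul (measurable_kernel_inv z)
  rw [integral_unitDisc_polar hm2 (integrableOn_div_kernel hi' hz)]
  have h1 : ∀ r ∈ Set.Ioo (0 : ℝ) 1, (r : ℂ) * ((2 * Real.pi) *
      Real.circleAverage (fun w => h' w / (1 - z * (starRingEnd ℂ) w) ^ 2) 0 r) =
      (r : ℂ) * ((2 * Real.pi) * deriv (fun ζ => ζ * h ζ) (z * r ^ 2)) := by
    intro r hr
    rw [← circleAverage_mul_kernel hd hz hr.1 hr.2]
    congr 2
    refine Real.circleAverage_congr_sphere fun ζ hζ => ?_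
    rw [heq]
    have hζn : ‖ζ‖ = r := by simpa [abs_of_pos hr.1] using hζ
    simpa [hζn] using hr.2
  rw [setIntegral_congr_fun measurableSet_Ioo h1, ← integral_Ioc_eq_integral_Ioo,
    ← intervalIntegral.integral_of_le zero_le_one]
  rw [intervalIntegral.integral_eq_sub_of_hasDerivAt
    (f := fun r : ℝ => Real.pi * (r : ℂ) ^ 2 * h (z * r ^ 2))]
  · simp
  · intro r hr
    rw [Set.uIcc_of_le zero_le_one] at hr
    exact hasDerivAt_mul_kernel_antideriv hd hz hr
  · refine ContinuousOn.intervalIntegrable ?_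
    rw [Set.uIcc_of_le zero_le_one]
    have hd2 : DifferentiableOn ℂ (fun ζ => ζ * h ζ) (ball 0 1) := by fun_prop
    have hd3 : ContinuousOn (deriv (fun ζ => ζ * h ζ)) (ball 0 1) :=
      (hd2.deriv isOpen_ball).continuousOn
    have hd4 : ContinuousOn (fun r : ℝ => deriv (fun ζ => ζ * h ζ) (z * r ^ 2)) (Set.Icc 0 1) := by
      refine hd3.comp (by fun_prop) fun r hr => ?_
      simp only [mem_ball, dist_zero_right, norm_mul, norm_pow, Complex.norm_real,
        Real.norm_eq_abs, abs_of_nonneg hr.1]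
      nlinarith [norm_nonneg z, pow_le_one₀ hr.1 hr.2 (n := 2)]
    fun_prop

theorem integral_unitDisc_kernel {z : ℂ} (hz : ‖z‖ < 1) :
    ∫ w in ball (0 : ℂ) 1, ((1 - z * (starRingEnd ℂ) w) ^ 2)⁻¹ = (Real.pi : ℂ) := by
  have := integral_unitDisc_reproducing (h := fun _ => 1) (differentiableOn_const 1)
    (integrableOn_const measure_ball_lt_top.ne) hz
  simpa using this

/-- By `circleAverage_mul_kernel` with `h = 1`, the kernel has mean `1` on every circle, so the
result does not depend on `z`. -/
theorem integral_unitDisc_radial_mul_kernel {φ : ℝ → ℝ} (hφ : Measurable φ)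
    (hi : IntegrableOn (fun w : ℂ => (φ ‖w‖ : ℂ)) (ball 0 1)) {z : ℂ} (hz : ‖z‖ < 1) :
    ∫ w in ball (0 : ℂ) 1, (φ ‖w‖ : ℂ) / (1 - z * (starRingEnd ℂ) w) ^ 2 =
      ((2 * Real.pi * ∫ r in Set.Ioo (0 : ℝ) 1, r * φ r : ℝ) : ℂ) := by
  have hm2 : Measurable fun w : ℂ => (φ ‖w‖ : ℂ) / (1 - z * (starRingEnd ℂ) w) ^ 2 := by
    simp only [div_eq_mul_inv]
    exact (Complex.measurable_ofReal.comp (hφ.comp measurable_norm)).mul (measurable_kernel_inv z)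
  rw [integral_unitDisc_polar hm2 (integrableOn_div_kernel hi hz), ← integral_const_mul,
    ← integral_complex_ofReal]
  refine setIntegral_congr_fun measurableSet_Ioo fun r hr => ?_
  have h1 : Real.circleAverage (fun w => (φ ‖w‖ : ℂ) / (1 - z * (starRingEnd ℂ) w) ^ 2) 0 r =
      (φ r : ℂ) := by
    have h2 := circleAverage_mul_kernel (h := fun _ => 1) (differentiableOn_const 1) hz hr.1 hr.2
    have h3 : deriv (fun ζ : ℂ => ζ * 1) (z * r ^ 2) = 1 := by simp
    rw [h3] at h2
    rw [Real.circleAverage_congr_sphere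
      (f₂ := fun w => (φ r : ℂ) • (1 / (1 - z * (starRingEnd ℂ) w) ^ 2)),
      Real.circleAverage_fun_smul, h2]
    · simp
    · intro ζ hζ
      have hζn : ‖ζ‖ = r := by simpa [abs_of_pos hr.1] using hζ
      simp only [hζn, smul_eq_mul]
      ring
  simp only [h1]
  push_cast
  ring

/-! ### Square-integrable holomorphic functions on the punctured disc. -/

/-- Balls of `ℂ × ℂ` are bidiscs, so the two-variable inequality for a function of the first
coordinate yields this one after cancelling the area of the second disc. -/
theorem enorm_mul_volume_ball_le_one_var {h : ℂ → ℂ} {z : ℂ} {r : ℝ} (hr : 0 < r)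
    (hd : DifferentiableOn ℂ h (ball z r)) :
    ‖h z‖ₑ * volume (ball (0 : ℂ) r) ≤ ∫⁻ w in ball z r, ‖h w‖ₑ := by
  have h1 := enorm_mul_volume_ball_le (g := fun w : ℂ × ℂ => h w.1) (z := (z, 0)) (r := r)
    (hd.comp differentiableOn_fst fun w hw => by
      rw [← ball_prod_same] at hw; exact hw.1)
  have hm : AEMeasurable (fun w => ‖h w‖ₑ) (volume.restrict (ball z r)) :=
    (hd.continuousOn.aemeasurable measurableSet_ball).enorm
  have h2 := lintegral_prod_mul (ν := volume.restrict (ball (0 : ℂ) r)) hm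
    (aemeasurable_const (b := (1 : ℝ≥0∞)))
  simp only [mul_one, lintegral_const, one_mul, Measure.restrict_apply_univ] at h2
  rw [← ball_prod_same, ← Prod.mk_zero_zero, ← ball_prod_same, Measure.volume_eq_prod,
    Measure.prod_prod, ← Measure.prod_restrict, h2, ← mul_assoc] at h1
  exact (ENNReal.mul_le_mul_iff_left (measure_ball_pos _ _ hr).ne' measure_ball_lt_top.ne).1 h1

/-- The mean value inequality for `h²` on the disc of radius `|z|/2` about `z` bounds `π |z|²
|h(z)|² / 4` by the integral of `|h|²` over `|w| < 2|z|`, which tends to `0`. -/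
theorem isLittleO_inv_of_lintegral_sq {h : ℂ → ℂ}
    (hd : DifferentiableOn ℂ h (ball 0 1 \ {0}))
    (hi : ∫⁻ w in ball (0 : ℂ) 1, ‖h w‖ₑ ^ 2 ≠ ∞) :
    h =o[𝓝[≠] 0] fun z => z⁻¹ := by
  have hlim : Tendsto (fun z : ℂ => ∫⁻ w in ball 0 (2 * ‖z‖), ‖h w‖ₑ ^ 2
      ∂(volume.restrict (ball (0 : ℂ) 1))) (𝓝[≠] 0) (𝓝 0) := by
    refine tendsto_setLIntegral_zero hi ?_
    refine tendsto_of_tendsto_of_tendsto_of_le_of_le tendsto_const_nhds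
      (h := fun z : ℂ => ENNReal.ofReal (2 * ‖z‖) ^ 2 * NNReal.pi) ?_
      (fun _ => zero_le) (fun z => ?_)
    · refine Tendsto.mono_left ?_ nhdsWithin_le_nhds
      have hc : Continuous fun z : ℂ => ENNReal.ofReal (2 * ‖z‖) ^ 2 * NNReal.pi :=
        ENNReal.continuous_mul_const ENNReal.coe_ne_top |>.comp
          ((ENNReal.continuous_pow 2).comp (ENNReal.continuous_ofReal.comp (by fun_prop)))
      simpa using hc.tendsto 0
    · refine (Measure.restrict_apply_le _ _).trans ?_
      rw [Complex.volume_ball]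
  refine Asymptotics.isLittleO_iff.2 fun ε hε => ?_
  have hε' : (0 : ℝ≥0∞) < ENNReal.ofReal (ε ^ 2 / 4 * Real.pi) := by
    rw [ENNReal.ofReal_pos]; positivity
  have hsmall : ∀ᶠ z : ℂ in 𝓝[≠] 0, ‖z‖ < 1 / 2 :=
    nhdsWithin_le_nhds (by simpa [ball, dist_eq_norm] using ball_mem_nhds (0 : ℂ) (half_pos one_pos))
  filter_upwards [hlim.eventually (gt_mem_nhds hε'), hsmall, self_mem_nhdsWithin] with z h1 h2 h3
  have hz0 : 0 < ‖z‖ := norm_pos_iff.2 h3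
  have hsub : ball z (‖z‖ / 2) ⊆ ball 0 1 \ {0} := by
    intro w hw
    rw [mem_ball, dist_eq_norm] at hw
    refine ⟨?_, ?_⟩
    · rw [mem_ball_zero_iff]
      linarith [norm_le_norm_add_norm_sub' w z]
    · rintro rfl
      simp at hw
      linarith
  have hsub2 : ball z (‖z‖ / 2) ⊆ ball 0 (2 * ‖z‖) := by
    intro w hw
    rw [mem_ball, dist_eq_norm] at hw
    rw [mem_ball_zero_iff]
    linarith [norm_le_norm_add_norm_sub' w z]
  have h4 := enorm_mul_volume_ball_le_one_var (half_pos hz0) ((hd.mono hsub).pow 2)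
  have h5 : ∫⁻ w in ball z (‖z‖ / 2), ‖(h ^ 2) w‖ₑ ≤ ENNReal.ofReal (ε ^ 2 / 4 * Real.pi) := by
    refine le_trans ?_ h1.le
    rw [Measure.restrict_restrict measurableSet_ball]
    simp only [Pi.pow_apply, enorm_pow]
    exact lintegral_mono_set fun w hw => ⟨hsub2 hw, (hsub hw).1⟩
  have h6 := h4.trans h5
  rw [Complex.volume_ball, Pi.pow_apply, enorm_pow, ← ofReal_norm (h z),
    ← ENNReal.ofReal_pow (norm_nonneg _), ← ENNReal.ofReal_pow (by positivity),
    show (NNReal.pi : ℝ≥0∞) = ENNReal.ofReal Real.pi by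
      rw [← NNReal.coe_real_pi, ENNReal.ofReal_coe_nnreal],
    ← ENNReal.ofReal_mul (by positivity), ← ENNReal.ofReal_mul (by positivity),
    ENNReal.ofReal_le_ofReal_iff (by positivity)] at h6
  have h7 : (‖h z‖ * ‖z‖) ^ 2 ≤ ε ^ 2 := by
    have : (‖h z‖ * ‖z‖) ^ 2 / 4 * Real.pi ≤ ε ^ 2 / 4 * Real.pi := by
      calc _ = ‖h z‖ ^ 2 * ((‖z‖ / 2) ^ 2 * Real.pi) := by ring
        _ ≤ _ := h6
    have := le_of_mul_le_mul_right this Real.pi_pos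
    linarith
  have h8 := (le_abs_self _).trans (abs_le_of_sq_le_sq h7 hε.le)
  rw [norm_inv, ← div_eq_mul_inv, le_div_iff₀ hz0]
  exact h8

theorem exists_holomorphic_extension_of_lintegral_sq {h : ℂ → ℂ}
    (hd : DifferentiableOn ℂ h (ball 0 1 \ {0}))
    (hi : ∫⁻ w in ball (0 : ℂ) 1, ‖h w‖ₑ ^ 2 ≠ ∞) :
    ∃ H : ℂ → ℂ, DifferentiableOn ℂ H (ball 0 1) ∧ Set.EqOn H h (ball 0 1 \ {0}) := by
  refine ⟨_, Complex.differentiableOn_update_limUnder_of_isLittleO (ball_mem_nhds 0 one_pos) hd ?_,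
    fun w hw => Function.update_of_ne hw.2 _ _⟩
  simp only [sub_zero]
  -- The subtracted `h 0` is an arbitrary value, but any constant is `o(1/z)`.
  refine (isLittleO_inv_of_lintegral_sq hd hi).sub ?_
  exact Asymptotics.isLittleO_const_left.2 (Or.inr tendsto_norm_inv_nhdsNE_zero_atTop)

theorem integrableOn_of_lintegral_sq {α : Type*} [MeasurableSpace α] {μ : Measure α}
    [IsFiniteMeasure μ] {h : α → ℂ} (hm : AEStronglyMeasurable h μ)
    (hi : ∫⁻ w, ‖h w‖ₑ ^ 2 ∂μ ≠ ∞) : Integrable h μ := by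
  have : MemLp h 2 μ := ⟨hm, by
    rw [eLpNorm_lt_top_iff_lintegral_rpow_enorm_lt_top two_ne_zero ENNReal.ofNat_ne_top]
    simpa using hi.lt_top⟩
  exact this.integrable one_le_two

instance isFiniteMeasure_restrict_unitDisc :
    IsFiniteMeasure (volume.restrict (ball (0 : ℂ) 1)) :=
  ⟨by simp⟩

/-- The reproducing property for square-integrable holomorphic functions on the punctured disc. -/
theorem integral_puncturedDisc_reproducing {h : ℂ → ℂ}
    (hd : DifferentiableOn ℂ h (ball 0 1 \ {0}))
    (hi : ∫⁻ w in ball (0 : ℂ) 1, ‖h w‖ₑ ^ 2 ≠ ∞) {z : ℂ} (hz : ‖z‖ < 1) (hz0 : z ≠ 0) :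
    ∫ w in ball (0 : ℂ) 1, h w / (1 - z * (starRingEnd ℂ) w) ^ 2 = Real.pi * h z := by
  obtain ⟨H, hH, hHh⟩ := exists_holomorphic_extension_of_lintegral_sq hd hi
  have hae : H =ᵐ[volume.restrict (ball (0 : ℂ) 1)] h := by
    filter_upwards [ae_restrict_mem measurableSet_ball, ae_restrict_of_ae
      (show ∀ᵐ w : ℂ, w ≠ 0 by simp [ae_iff])] with w h1 h2
    exact hHh ⟨h1, h2⟩
  have hint : IntegrableOn H (ball 0 1) := by
    refine integrableOn_of_lintegral_sq
      (hH.continuousOn.aestronglyMeasurable measurableSet_ball) ?_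
    rwa [lintegral_congr_ae (g := fun w => ‖h w‖ₑ ^ 2) (hae.mono fun w hw => by simp only [hw])]
  rw [← hHh ⟨by simpa using hz, hz0⟩, ← integral_unitDisc_reproducing hH hint hz]
  exact integral_congr_ae (hae.mono fun w hw => by simp only [hw])

/-! ### Change of variables from the bidisc to the Hartogs triangle. -/

/-- The real determinant of multiplication by `w` is the norm of `w` in `ℂ/ℝ`, namely `|w|²`. -/
theorem lintegral_comp_mul_left_complex {G : ℂ → ℝ≥0∞} (hG : Measurable G) {w : ℂ} (hw : w ≠ 0) :
    ∫⁻ z, G z = ‖w‖ₑ ^ 2 * ∫⁻ u, G (w * u) := by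
  have hdet : LinearMap.det (Algebra.lmul ℝ ℂ w) = ‖w‖ ^ 2 := by
    rw [← Algebra.norm_apply, Algebra.norm_complex_apply, Complex.normSq_eq_norm_sq]
  have hpos : 0 < ‖w‖ ^ 2 := by positivity
  have h1 := Measure.map_linearMap_addHaar_eq_smul_addHaar (volume : Measure ℂ)
    (f := Algebra.lmul ℝ ℂ w) (by rw [hdet]; exact hpos.ne')
  have hm : Measurable (Algebra.lmul ℝ ℂ w) := by
    have : (Algebra.lmul ℝ ℂ w : ℂ → ℂ) = fun u => w * u := rfl
    rw [this]; fun_prop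
  have h2 : ∫⁻ u, G (w * u) = ∫⁻ z, G z ∂(volume.map (Algebra.lmul ℝ ℂ w)) := by
    rw [lintegral_map hG hm]; rfl
  rw [h2, h1, lintegral_smul_measure, hdet, abs_of_pos (inv_pos.2 hpos), smul_eq_mul, ← mul_assoc,
    ← ofReal_norm w, ← ENNReal.ofReal_pow (norm_nonneg w), ← ENNReal.ofReal_mul hpos.le,
    mul_inv_cancel₀ hpos.ne', ENNReal.ofReal_one, one_mul]

/-- The map `(u, w) ↦ (u w, w)` from the bidisc onto the Hartogs triangle. -/
def hartogsMap (x : ℂ × ℂ) : ℂ × ℂ := (x.1 * x.2, x.2)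

theorem measurable_hartogsMap : Measurable hartogsMap := by
  unfold hartogsMap; fun_prop

/-- Lebesgue measure on the bidisc. -/
noncomputable abbrev bidiscMeasure : Measure (ℂ × ℂ) :=
  (volume.restrict (ball (0 : ℂ) 1)).prod (volume.restrict (ball (0 : ℂ) 1))

theorem hartogsMap_mem {x : ℂ × ℂ} (h1 : ‖x.1‖ < 1) (h2 : ‖x.2‖ < 1) (h0 : x.2 ≠ 0) :
    hartogsMap x ∈ hartogsTriangle := by
  refine ⟨?_, h2⟩
  simp only [hartogsMap, norm_mul]
  have := norm_pos_iff.2 h0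
  nlinarith

theorem snd_ne_zero_of_mem_hartogsTriangle {z : ℂ × ℂ} (hz : z ∈ hartogsTriangle) : z.2 ≠ 0 :=
  norm_pos_iff.1 ((norm_nonneg _).trans_lt hz.1)

theorem norm_div_lt_one_of_mem_hartogsTriangle {z : ℂ × ℂ} (hz : z ∈ hartogsTriangle) :
    ‖z.1 / z.2‖ < 1 := by
  rw [norm_div, div_lt_one (norm_pos_iff.2 (snd_ne_zero_of_mem_hartogsTriangle hz))]
  exact hz.1

/-- On the slice `z₂ = w` with `0 < |w| < 1` the domain is the disc `|z₁| < |w|`, which is `w` times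
the unit disc. -/
theorem lintegral_hartogsMeasure {F : ℂ × ℂ → ℝ≥0∞} (hF : Measurable F) :
    ∫⁻ z, F z ∂hartogsMeasure = ∫⁻ x, ‖x.2‖ₑ ^ 2 * F (hartogsMap x) ∂bidiscMeasure := by
  have hmeas : MeasurableSet hartogsTriangle := isOpen_hartogsTriangle.measurableSet
  have hΦ := measurable_hartogsMap
  have hFm : Measurable (hartogsTriangle.indicator F) := hF.indicator hmeas
  rw [← lintegral_indicator hmeas, Measure.volume_eq_prod, lintegral_prod_symm _ hFm.aemeasurable,
    lintegral_prod_symm _ (by fun_prop), ← lintegral_indicator measurableSet_ball]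
  refine lintegral_congr_ae ?_
  filter_upwards [show ∀ᵐ w : ℂ, w ≠ 0 by simp [ae_iff]] with w hw
  rw [lintegral_comp_mul_left_complex (G := fun u => hartogsTriangle.indicator F (u, w))
    (hFm.comp (by fun_prop)) hw]
  by_cases h : w ∈ ball (0 : ℂ) 1
  · rw [Set.indicator_of_mem h, lintegral_const_mul _ (by
      unfold hartogsMap; fun_prop), ← lintegral_indicator measurableSet_ball]
    congr 1
    refine lintegral_congr fun u => ?_
    have hw0 := norm_pos_iff.2 hw
    have h' : ‖w‖ < 1 := by simpa using h
    have : (w * u, w) ∈ hartogsTriangle ↔ u ∈ ball (0 : ℂ) 1 := by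
      simp only [hartogsTriangle, Set.mem_ofPred_eq, norm_mul, h', and_true, mem_ball_zero_iff]
      constructor
      · intro h3; nlinarith
      · intro h3; nlinarith
    by_cases hu : u ∈ ball (0 : ℂ) 1
    · rw [Set.indicator_of_mem hu, Set.indicator_of_mem (this.2 hu), hartogsMap, mul_comm u w]
    · rw [Set.indicator_of_notMem hu, Set.indicator_of_notMem (mt this.1 hu)]
  · rw [Set.indicator_of_notMem h]
    have h' : ¬ ‖w‖ < 1 := by simpa using h
    have : ∀ u, hartogsTriangle.indicator F (w * u, w) = 0 := fun u =>
      Set.indicator_of_notMem (fun hm => h' hm.2) _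
    simp [this]

/-- The change of variables as an identity of measures, in which form it also applies to Bochner
integrals. -/
theorem measurePreserving_hartogsMap :
    MeasurePreserving hartogsMap
      (bidiscMeasure.withDensity fun x => ((‖x.2‖₊ ^ 2 : NNReal) : ℝ≥0∞)) hartogsMeasure := by
  refine ⟨measurable_hartogsMap, Measure.ext fun s hs => ?_⟩
  rw [Measure.map_apply measurable_hartogsMap hs, withDensity_apply _ (measurable_hartogsMap hs),
    ← lintegral_indicator_one hs,
    lintegral_hartogsMeasure (measurable_one.indicator hs),
    ← lintegral_indicator (measurable_hartogsMap hs)]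
  refine lintegral_congr fun x => ?_
  by_cases h : hartogsMap x ∈ s
  · rw [Set.indicator_of_mem h, Set.indicator_of_mem (by exact h)]
    simp [enorm_eq_nnnorm]
  · rw [Set.indicator_of_notMem h, Set.indicator_of_notMem (by exact h)]
    simp

theorem integral_hartogsMeasure {F : ℂ × ℂ → ℂ} (hF : AEStronglyMeasurable F hartogsMeasure) :
    ∫ z, F z ∂hartogsMeasure = ∫ x, (‖x.2‖ : ℂ) ^ 2 * F (hartogsMap x) ∂bidiscMeasure := by
  rw [← measurePreserving_hartogsMap.map_eq,
    integral_map measurable_hartogsMap.aemeasurable (by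
      rwa [measurePreserving_hartogsMap.map_eq]),
    integral_withDensity_eq_integral_smul (by fun_prop)]
  refine integral_congr_ae (Eventually.of_forall fun x => ?_)
  simp [NNReal.smul_def]

instance isFiniteMeasure_hartogsMeasure : IsFiniteMeasure hartogsMeasure := by
  refine ⟨?_⟩
  rw [Measure.restrict_apply_univ]
  refine (measure_mono (t := ball (0 : ℂ × ℂ) 1) fun z hz => ?_).trans_lt measure_ball_lt_top
  rw [mem_ball_zero_iff, Prod.norm_def]
  exact max_lt (hz.1.trans hz.2) hz.2

/-- The disc in `z₁ / z₂` contributes `π`, polar coordinates `2πr`, and the Jacobian `r²`. The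
resulting `r³` makes `4` the critical exponent for `1/z₂`. -/
theorem lintegral_hartogs_norm_snd {φ : ℝ → ℝ≥0∞} (hφ : Measurable φ) :
    ∫⁻ z, φ ‖z.2‖ ∂hartogsMeasure =
      ENNReal.ofReal (2 * Real.pi ^ 2) *
        ∫⁻ r in Set.Ioo (0 : ℝ) 1, ENNReal.ofReal (r ^ 3) * φ r := by
  rw [lintegral_hartogsMeasure (by fun_prop)]
  have h1 := lintegral_prod_mul (μ := volume.restrict (ball (0 : ℂ) 1))
    (ν := volume.restrict (ball (0 : ℂ) 1)) (aemeasurable_const (b := (1 : ℝ≥0∞)))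
    (g := fun w => ENNReal.ofReal (‖w‖ ^ 2) * φ ‖w‖) (by fun_prop)
  have h2 : ∀ x : ℂ × ℂ, ‖x.2‖ₑ ^ 2 * φ ‖(hartogsMap x).2‖ =
      1 * (ENNReal.ofReal (‖x.2‖ ^ 2) * φ ‖x.2‖) := fun x => by
    rw [one_mul, ENNReal.ofReal_pow (norm_nonneg _), ofReal_norm]
    rfl
  simp only [h2]
  rw [h1, lintegral_unitDisc_norm (φ := fun r => ENNReal.ofReal (r ^ 2) * φ r) (by fun_prop)]
  simp only [lintegral_const, one_mul, Measure.restrict_apply_univ, Complex.volume_ball,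
    ENNReal.ofReal_one, one_pow]
  rw [show (NNReal.pi : ℝ≥0∞) = ENNReal.ofReal Real.pi by
      rw [← NNReal.coe_real_pi, ENNReal.ofReal_coe_nnreal], ← mul_assoc,
    ← ENNReal.ofReal_mul Real.pi_pos.le]
  congr 1
  · congr 1; ring
  · refine setLIntegral_congr_fun measurableSet_Ioo fun r hr => ?_
    rw [← mul_assoc, ← ENNReal.ofReal_mul hr.1.le]
    congr 2; ring

/-! ### The Bergman kernel of the Hartogs triangle and the integral formula for `P`. -/

/-- The Bergman kernel of the Hartogs triangle. -/
noncomputable def hartogsKernel (z w : ℂ × ℂ) : ℂ :=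
  ((Real.pi : ℂ) ^ 2)⁻¹ * (z.2 * (starRingEnd ℂ) w.2)⁻¹ *
    ((1 - z.2 * (starRingEnd ℂ) w.2) ^ 2)⁻¹ *
    ((1 - z.1 / z.2 * (starRingEnd ℂ) (w.1 / w.2)) ^ 2)⁻¹

theorem measurable_conj_complex : Measurable (starRingEnd ℂ) := Complex.continuous_conj.measurable

theorem measurable_hartogsKernel :
    Measurable (fun x : (ℂ × ℂ) × (ℂ × ℂ) => hartogsKernel x.1 x.2) := by
  have := measurable_conj_complex
  unfold hartogsKernel
  fun_prop

theorem measurable_hartogsKernel_right (z : ℂ × ℂ) : Measurable (hartogsKernel z) := by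
  have := measurable_conj_complex
  unfold hartogsKernel
  fun_prop

theorem conj_hartogsKernel (z w : ℂ × ℂ) :
    (starRingEnd ℂ) (hartogsKernel z w) = hartogsKernel w z := by
  simp only [hartogsKernel, map_mul, map_inv₀, map_pow, map_sub, map_one, Complex.conj_conj,
    Complex.conj_ofReal, map_div₀]
  rw [mul_comm ((starRingEnd ℂ) z.2), mul_comm ((starRingEnd ℂ) z.1 / (starRingEnd ℂ) z.2)]

theorem differentiableOn_hartogsKernel {z : ℂ × ℂ} (hz : z ∈ hartogsTriangle) :
    DifferentiableOn ℂ (fun w => hartogsKernel w z) hartogsTriangle := by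
  have hz0 := snd_ne_zero_of_mem_hartogsTriangle hz
  unfold hartogsKernel
  refine DifferentiableOn.mul (DifferentiableOn.mul (DifferentiableOn.const_mul ?_ _) ?_) ?_
  · refine DifferentiableOn.fun_inv (by fun_prop) fun w hw => ?_
    exact mul_ne_zero (snd_ne_zero_of_mem_hartogsTriangle hw) (by simpa using hz0)
  · refine DifferentiableOn.fun_inv (by fun_prop) fun w hw => pow_ne_zero _ ?_
    exact one_sub_ne_zero_of_norm_lt (norm_mul_conj_lt_one hw.2 hz.2)
  · refine DifferentiableOn.fun_inv ?_ fun w hw => pow_ne_zero _ ?_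
    · refine (DifferentiableOn.const_sub (DifferentiableOn.mul_const ?_ _) _).pow 2
      simp only [div_eq_mul_inv]
      exact DifferentiableOn.mul (by fun_prop) (DifferentiableOn.fun_inv (by fun_prop)
        fun w hw => snd_ne_zero_of_mem_hartogsTriangle hw)
    · exact one_sub_ne_zero_of_norm_lt (norm_mul_conj_lt_one
        (norm_div_lt_one_of_mem_hartogsTriangle hw) (norm_div_lt_one_of_mem_hartogsTriangle hz))

/-- For fixed `z` the only singularity in `w` is `1/w̄₂`; hence `hartogsKernel z` lies in `L^q` for
`0 < q < 4`. -/
theorem exists_norm_hartogsKernel_le {z : ℂ × ℂ} (hz : z ∈ hartogsTriangle) :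
    ∃ C : ℝ, ∀ w ∈ hartogsTriangle, ‖hartogsKernel z w‖ ≤ C * ‖w.2‖⁻¹ := by
  refine ⟨‖((Real.pi : ℂ) ^ 2)⁻¹‖ * ‖z.2‖⁻¹ * ((1 - ‖z.2‖) ^ 2)⁻¹ * ((1 - ‖z.1 / z.2‖) ^ 2)⁻¹,
    fun w hw => ?_⟩
  have h1 := norm_kernel_inv_le hz.2 hw.2
  have h2 := norm_kernel_inv_le (norm_div_lt_one_of_mem_hartogsTriangle hz)
    (norm_div_lt_one_of_mem_hartogsTriangle hw)
  unfold hartogsKernel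
  rw [norm_mul, norm_mul, norm_mul, norm_inv (z.2 * _), norm_mul z.2, RCLike.norm_conj, mul_inv]
  calc _ ≤ ‖((Real.pi : ℂ) ^ 2)⁻¹‖ * (‖z.2‖⁻¹ * ‖w.2‖⁻¹) * ((1 - ‖z.2‖) ^ 2)⁻¹ *
        ((1 - ‖z.1 / z.2‖) ^ 2)⁻¹ := by gcongr
    _ = _ := by ring

theorem lintegral_hartogs_rpow_norm_snd {s : ℝ} (hs : s < 4) :
    ∫⁻ z, ENNReal.ofReal (‖z.2‖ ^ (-s)) ∂hartogsMeasure =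
      ENNReal.ofReal (2 * Real.pi ^ 2 / (4 - s)) := by
  rw [lintegral_hartogs_norm_snd (φ := fun r => ENNReal.ofReal (r ^ (-s))) (by fun_prop)]
  have h1 : ∀ r ∈ Set.Ioo (0 : ℝ) 1, ENNReal.ofReal (r ^ 3) * ENNReal.ofReal (r ^ (-s)) =
      ENNReal.ofReal (r ^ (3 - s)) := fun r hr => by
    have := hr.1
    rw [← ENNReal.ofReal_mul (by positivity), sub_eq_add_neg, Real.rpow_add this]
    norm_cast
  rw [setLIntegral_congr_fun measurableSet_Ioo h1, lintegral_Ioo_rpow (by linarith),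
    ← ENNReal.ofReal_mul (by positivity)]
  congr 1
  rw [show 3 - s + 1 = 4 - s by ring]
  ring

theorem memLp_inv_snd {q : ℝ} (hq0 : 0 < q) (hq : q < 4) :
    MemLp (fun z : ℂ × ℂ => z.2⁻¹) (ENNReal.ofReal q) hartogsMeasure := by
  refine ⟨by fun_prop, ?_⟩
  rw [eLpNorm_lt_top_iff_lintegral_rpow_enorm_lt_top (by simpa using hq0) ENNReal.ofReal_ne_top,
    ENNReal.toReal_ofReal hq0.le]
  have h1 : ∀ᵐ z ∂hartogsMeasure, ‖z.2⁻¹‖ₑ ^ q = ENNReal.ofReal (‖z.2‖ ^ (-q)) := by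
    filter_upwards [ae_restrict_mem isOpen_hartogsTriangle.measurableSet] with z hz
    have h0 := norm_pos_iff.2 (snd_ne_zero_of_mem_hartogsTriangle hz)
    rw [← ofReal_norm, ENNReal.ofReal_rpow_of_pos (by rw [norm_inv]; positivity), norm_inv,
      Real.inv_rpow h0.le, Real.rpow_neg h0.le]
  rw [lintegral_congr_ae h1, lintegral_hartogs_rpow_norm_snd hq]
  exact ENNReal.ofReal_lt_top

theorem memLp_hartogsKernel {z : ℂ × ℂ} (hz : z ∈ hartogsTriangle) {q : ℝ} (hq0 : 0 < q)
    (hq : q < 4) : MemLp (hartogsKernel z) (ENNReal.ofReal q) hartogsMeasure := by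
  obtain ⟨C, hC⟩ := exists_norm_hartogsKernel_le hz
  refine ((memLp_inv_snd hq0 hq).const_mul (C : ℂ)).mono
    (measurable_hartogsKernel_right z).aestronglyMeasurable ?_
  filter_upwards [ae_restrict_mem isOpen_hartogsTriangle.measurableSet] with w hw
  refine (hC w hw).trans ?_
  rw [norm_mul, norm_inv, Complex.norm_real]
  gcongr
  exact le_abs_self _

/-- The Jacobian `|x₂|² = x₂ x̄₂` cancels the `x̄₂` in the denominator of the kernel, leaving the
pulled-back function `x₂ f(x₁ x₂, x₂)` against the bidisc kernel. -/
theorem integral_hartogsKernel_mul {z : ℂ × ℂ} {f : ℂ × ℂ → ℂ}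
    (hf : AEStronglyMeasurable f hartogsMeasure) :
    ∫ w, hartogsKernel z w * f w ∂hartogsMeasure =
      ((Real.pi : ℂ) ^ 2)⁻¹ * z.2⁻¹ * ∫ x, (x.2 * f (hartogsMap x)) *
        ((1 - z.2 * (starRingEnd ℂ) x.2) ^ 2)⁻¹ *
        ((1 - z.1 / z.2 * (starRingEnd ℂ) x.1) ^ 2)⁻¹ ∂bidiscMeasure := by
  rw [integral_hartogsMeasure (F := fun w => hartogsKernel z w * f w)
      ((measurable_hartogsKernel_right z).aestronglyMeasurable.mul hf), ← integral_const_mul]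
  refine integral_congr_ae (Eventually.of_forall fun x => ?_)
  rcases eq_or_ne x.2 0 with h0 | h0
  · simp [h0]
  have hc : (starRingEnd ℂ) x.2 ≠ 0 := by simpa using h0
  have h1 : ((‖x.2‖ : ℂ)) ^ 2 = x.2 * (starRingEnd ℂ) x.2 := by
    rw [Complex.mul_conj, Complex.normSq_eq_norm_sq]; push_cast; rfl
  simp only [hartogsKernel, hartogsMap, mul_div_cancel_right₀ _ h0, h1, mul_inv]
  field_simp

/-- Fubini on the bidisc: the punctured-disc formula in the second variable at `z₂`, then the disc
formula in the first at `z₁ / z₂`. The latter needs the slice at `z₂` to be square-integrable, which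
Fubini gives only for almost every `z₂`; hence the almost-everywhere conclusion. -/
theorem integral_hartogsKernel_mul_of_measurable {g : ℂ × ℂ → ℂ} (hm : Measurable g)
    (hd : DifferentiableOn ℂ g hartogsTriangle)
    (hi : ∫⁻ w, ‖g w‖ₑ ^ 2 ∂hartogsMeasure ≠ ∞) :
    ∀ᵐ z ∂hartogsMeasure, ∫ w, hartogsKernel z w * g w ∂hartogsMeasure = g z := by
  have hΦ := measurable_hartogsMap
  have hconj := measurable_conj_complex
  set G : ℂ × ℂ → ℂ := fun x => x.2 * g (hartogsMap x) with hG
  have hGm : Measurable G := by fun_prop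
  have hGi : ∫⁻ x, ‖G x‖ₑ ^ 2 ∂bidiscMeasure ≠ ∞ := by
    rw [lintegral_hartogsMeasure (by fun_prop)] at hi
    simpa only [hG, enorm_mul, mul_pow] using hi
  have hGint : Integrable G bidiscMeasure :=
    integrableOn_of_lintegral_sq hGm.aestronglyMeasurable hGi
  have ae1 : ∀ᵐ v ∂(volume.restrict (ball (0 : ℂ) 1)),
      ∫⁻ w in ball (0 : ℂ) 1, ‖G (v, w)‖ₑ ^ 2 ≠ ∞ := by
    rw [lintegral_prod _ (by fun_prop)] at hGi
    exact (ae_lt_top' (by fun_prop) hGi).mono fun v hv => hv.ne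
  have ae2 : ∀ᵐ w ∂(volume.restrict (ball (0 : ℂ) 1)),
      ∫⁻ v in ball (0 : ℂ) 1, ‖G (v, w)‖ₑ ^ 2 ≠ ∞ := by
    rw [lintegral_prod_symm _ (by fun_prop)] at hGi
    exact (ae_lt_top' (by fun_prop) hGi).mono fun v hv => hv.ne
  have hGd1 : ∀ v, ‖v‖ < 1 → DifferentiableOn ℂ (fun w => G (v, w)) (ball 0 1 \ {0}) := by
    intro v hv
    refine differentiableOn_id.mul (hd.comp (by unfold hartogsMap; fun_prop) ?_)
    exact fun w hw => hartogsMap_mem hv (by simpa using hw.1) hw.2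
  have hGd2 : ∀ w, ‖w‖ < 1 → w ≠ 0 → DifferentiableOn ℂ (fun v => G (v, w)) (ball 0 1) := by
    intro w hw hw0
    refine DifferentiableOn.const_mul (hd.comp (by unfold hartogsMap; fun_prop) ?_) _
    exact fun v hv => hartogsMap_mem (by simpa using hv) hw hw0
  -- A null set of values of `z₂` has null preimage in `ℂ²`.
  have ae3 : ∀ᵐ z ∂hartogsMeasure, z.2 ∈ ball (0 : ℂ) 1 →
      ∫⁻ v in ball (0 : ℂ) 1, ‖G (v, z.2)‖ₑ ^ 2 ≠ ∞ := by
    refine ae_restrict_of_ae ?_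
    exact Measure.quasiMeasurePreserving_snd.ae
      ((ae_restrict_iff' measurableSet_ball).1 ae2)
  filter_upwards [ae3, ae_restrict_mem isOpen_hartogsTriangle.measurableSet] with z hz3 hz
  have hz0 := snd_ne_zero_of_mem_hartogsTriangle hz
  have hu := norm_div_lt_one_of_mem_hartogsTriangle hz
  rw [integral_hartogsKernel_mul hm.aestronglyMeasurable]
  have hint : Integrable (fun x : ℂ × ℂ => G x * ((1 - z.2 * (starRingEnd ℂ) x.2) ^ 2)⁻¹ *
      ((1 - z.1 / z.2 * (starRingEnd ℂ) x.1) ^ 2)⁻¹) bidiscMeasure := by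
    have hmem : ∀ᵐ x ∂bidiscMeasure, x ∈ ball (0 : ℂ) 1 ×ˢ ball (0 : ℂ) 1 := by
      unfold bidiscMeasure
      rw [Measure.prod_restrict]
      exact ae_restrict_mem (measurableSet_ball.prod measurableSet_ball)
    refine Integrable.mul_bdd (c := ((1 - ‖z.1 / z.2‖) ^ 2)⁻¹) (Integrable.mul_bdd
      (c := ((1 - ‖z.2‖) ^ 2)⁻¹) hGint ?_ ?_) ?_ ?_
    · exact ((measurable_kernel_inv _).comp measurable_snd).aestronglyMeasurable
    · exact hmem.mono fun x hx => norm_kernel_inv_le hz.2 (by simpa using hx.2)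
    · exact ((measurable_kernel_inv _).comp measurable_fst).aestronglyMeasurable
    · exact hmem.mono fun x hx => norm_kernel_inv_le hu (by simpa using hx.1)
  rw [integral_prod _ hint]
  have h1 : ∀ᵐ v ∂(volume.restrict (ball (0 : ℂ) 1)),
      ∫ w in ball (0 : ℂ) 1, G (v, w) * ((1 - z.2 * (starRingEnd ℂ) w) ^ 2)⁻¹ *
        ((1 - z.1 / z.2 * (starRingEnd ℂ) v) ^ 2)⁻¹ =
      Real.pi * (G (v, z.2) / (1 - z.1 / z.2 * (starRingEnd ℂ) v) ^ 2) := by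
    filter_upwards [ae1, ae_restrict_mem measurableSet_ball] with v hv1 hv2
    rw [integral_mul_const]
    have := integral_puncturedDisc_reproducing (hGd1 v (by simpa using hv2)) hv1 hz.2 hz0
    simp only [div_eq_mul_inv] at this ⊢
    rw [this]
    ring
  rw [integral_congr_ae h1, integral_const_mul,
    integral_unitDisc_reproducing (hGd2 z.2 hz.2 hz0)
      (integrableOn_of_lintegral_sq
        (hGm.comp (measurable_id.prodMk measurable_const)).aestronglyMeasurable (hz3 (by simpa using hz.2))) hu]
  have h2 : G (z.1 / z.2, z.2) = z.2 * g z := by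
    simp only [hG, hartogsMap, div_mul_cancel₀ _ hz0]
  rw [h2]
  have := Real.pi_ne_zero
  have : (Real.pi : ℂ) ≠ 0 := by exact_mod_cast this
  field_simp

/-- The reproducing property of the Bergman kernel of the Hartogs triangle. -/
theorem integral_hartogsKernel_mul_of_mem {f : Lp ℂ 2 hartogsMeasure}
    (hf : f ∈ bergmanSpace hartogsTriangle) :
    ∀ᵐ z ∂hartogsMeasure, ∫ w, hartogsKernel z w * f w ∂hartogsMeasure = f z := by
  classical
  obtain ⟨g, hg, hfg⟩ := hf
  set g' : ℂ × ℂ → ℂ := hartogsTriangle.piecewise g 0 with hg'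
  have hm : Measurable g' := hg.continuousOn.measurable_piecewise continuousOn_const
    isOpen_hartogsTriangle.measurableSet
  have heq : Set.EqOn g' g hartogsTriangle := fun w hw => by
    rw [hg', Set.piecewise_eq_of_mem _ _ _ hw]
  have hfg' : f =ᵐ[hartogsMeasure] g' := by
    filter_upwards [hfg, ae_restrict_mem isOpen_hartogsTriangle.measurableSet] with w h1 h2
    rw [h1, heq h2]
  have hi : ∫⁻ w, ‖g' w‖ₑ ^ 2 ∂hartogsMeasure ≠ ∞ := by
    have := (eLpNorm_lt_top_iff_lintegral_rpow_enorm_lt_top two_ne_zero ENNReal.ofNat_ne_top).1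
      ((Lp.memLp f).ae_eq hfg').2
    simpa using this.ne
  filter_upwards [integral_hartogsKernel_mul_of_measurable hm (hg.congr heq) hi, hfg'] with z h1 h2
  rw [h2, ← h1]
  exact integral_congr_ae (hfg'.mono fun w hw => by simp only [hw])

/-- The Bergman projection is the integral operator with the Bergman kernel. -/
theorem bergmanProjection_ae_eq (f : Lp ℂ 2 hartogsMeasure) :
    bergmanProjection f =ᵐ[hartogsMeasure]
      fun z => ∫ w, hartogsKernel z w * f w ∂hartogsMeasure := by
  have hmem : bergmanProjection f ∈ bergmanSpace hartogsTriangle :=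
    Submodule.starProjection_apply_mem _ _
  filter_upwards [integral_hartogsKernel_mul_of_mem hmem,
    ae_restrict_mem isOpen_hartogsTriangle.measurableSet] with z h1 hz
  rw [← h1]
  -- With `k_z = hartogsKernel · z` in `A²`, self-adjointness gives `⟨k_z, P f⟩ = ⟨P k_z, f⟩ = ⟨k_z,
  -- f⟩`, and the left side is `P f (z)` by the reproducing property.
  have hk : MemLp (fun w => hartogsKernel w z) 2 hartogsMeasure := by
    have h2 : MemLp (hartogsKernel z) 2 hartogsMeasure := by
      have := memLp_hartogsKernel hz (q := 2) (by norm_num) (by norm_num)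
      simpa using this
    refine h2.star.ae_eq (Eventually.of_forall fun w => ?_)
    exact conj_hartogsKernel z w
  have hkmem : hk.toLp ∈ bergmanSpace hartogsTriangle :=
    ⟨_, differentiableOn_hartogsKernel hz, hk.coeFn_toLp⟩
  have h3 : ∀ F : Lp ℂ 2 hartogsMeasure,
      ∫ w, hartogsKernel z w * F w ∂hartogsMeasure = inner ℂ hk.toLp F := by
    intro F
    rw [L2.inner_def]
    refine integral_congr_ae ?_
    filter_upwards [hk.coeFn_toLp] with w hw
    rw [hw, RCLike.inner_apply, conj_hartogsKernel, mul_comm]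
  rw [h3, h3]
  unfold bergmanProjection
  rw [← Submodule.inner_starProjection_left_eq_right,
    Submodule.starProjection_eq_self_iff.2 hkmem]

/-! ### Schur's test. -/

/-- Schur's test with two weights. -/
theorem lintegral_rpow_le_of_schur {α : Type*} [MeasurableSpace α] {μ : Measure α} [SFinite μ]
    {p q : ℝ} (hpq : p.HolderConjugate q) {K : α → α → ℝ≥0∞}
    (hK : Measurable (Function.uncurry K)) {f g h : α → ℝ≥0∞} (hf : Measurable f)
    (hg : Measurable g) (hh : Measurable h) (hg0 : ∀ᵐ w ∂μ, g w ≠ 0) (hgt : ∀ᵐ w ∂μ, g w ≠ ∞)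
    {C₁ C₂ : ℝ≥0∞} (h1 : ∀ᵐ z ∂μ, ∫⁻ w, K z w * g w ^ q ∂μ ≤ C₁ * h z ^ q)
    (h2 : ∀ᵐ w ∂μ, ∫⁻ z, K z w * h z ^ p ∂μ ≤ C₂ * g w ^ p) :
    ∫⁻ z, (∫⁻ w, K z w * f w ∂μ) ^ p ∂μ ≤ C₁ ^ (p / q) * C₂ * ∫⁻ w, f w ^ p ∂μ := by
  have hp0 := hpq.pos
  have hq0 := hpq.symm.pos
  have hKz : ∀ z, Measurable (K z) := fun z => hK.comp measurable_prodMk_left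
  have hKw : ∀ w, Measurable fun z => K z w := fun w => hK.comp measurable_prodMk_right
  have step : ∀ᵐ z ∂μ, (∫⁻ w, K z w * f w ∂μ) ^ p ≤
      C₁ ^ (p / q) * (h z ^ p * ∫⁻ w, K z w * ((g w)⁻¹ * f w) ^ p ∂μ) := by
    filter_upwards [h1] with z hz
    have hKz' := hKz z
    -- Hölder is applied to `K f = (K^(1/q) g)(K^(1/p) g⁻¹ f)`.
    have e1 : ∫⁻ w, K z w * f w ∂μ = ∫⁻ w, ((fun w => K z w ^ (1 / q) * g w) *
        fun w => K z w ^ (1 / p) * ((g w)⁻¹ * f w)) w ∂μ := by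
      refine lintegral_congr_ae ?_
      filter_upwards [hg0, hgt] with w hw0 hwt
      simp only [Pi.mul_apply]
      calc K z w * f w = K z w ^ (1 / q + 1 / p) * f w := by
            rw [one_div, one_div, add_comm, hpq.inv_add_inv_eq_one, ENNReal.rpow_one]
        _ = K z w ^ (1 / q) * K z w ^ (1 / p) * (g w * (g w)⁻¹) * f w := by
            rw [ENNReal.rpow_add_of_nonneg _ _ (by positivity) (by positivity),
              ENNReal.mul_inv_cancel hw0 hwt, mul_one]
        _ = _ := by ring
    have e2 := ENNReal.lintegral_mul_le_Lp_mul_Lq μ hpq.symm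
      (f := fun w => K z w ^ (1 / q) * g w)
      (g := fun w => K z w ^ (1 / p) * ((g w)⁻¹ * f w)) (by fun_prop) (by fun_prop)
    have e3 : ∀ w, (K z w ^ (1 / q) * g w) ^ q = K z w * g w ^ q := fun w => by
      rw [ENNReal.mul_rpow_of_nonneg _ _ hq0.le, ← ENNReal.rpow_mul, one_div_mul_cancel hq0.ne',
        ENNReal.rpow_one]
    have e4 : ∀ w, (K z w ^ (1 / p) * ((g w)⁻¹ * f w)) ^ p = K z w * ((g w)⁻¹ * f w) ^ p :=
      fun w => by
        rw [ENNReal.mul_rpow_of_nonneg _ _ hp0.le, ← ENNReal.rpow_mul, one_div_mul_cancel hp0.ne',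
          ENNReal.rpow_one]
    simp only [e3, e4] at e2
    rw [← e1] at e2
    calc (∫⁻ w, K z w * f w ∂μ) ^ p ≤ _ := ENNReal.rpow_le_rpow e2 hp0.le
      _ ≤ ((C₁ * h z ^ q) ^ (1 / q) *
          (∫⁻ w, K z w * ((g w)⁻¹ * f w) ^ p ∂μ) ^ (1 / p)) ^ p := by gcongr
      _ = _ := by
        rw [ENNReal.mul_rpow_of_nonneg _ _ hp0.le, ← ENNReal.rpow_mul, ← ENNReal.rpow_mul,
          one_div_mul_cancel hp0.ne', ENNReal.rpow_one, one_div_mul_eq_div,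
          ENNReal.mul_rpow_of_nonneg _ _ (by positivity), ← ENNReal.rpow_mul,
          mul_div_cancel₀ _ hq0.ne', mul_assoc]
  have hm1 : Measurable fun x : α × α => h x.1 ^ p * (K x.1 x.2 * ((g x.2)⁻¹ * f x.2) ^ p) := by
    have : Measurable fun x : α × α => K x.1 x.2 := hK
    fun_prop
  calc _ ≤ ∫⁻ z, C₁ ^ (p / q) * (h z ^ p * ∫⁻ w, K z w * ((g w)⁻¹ * f w) ^ p ∂μ) ∂μ :=
        lintegral_mono_ae step
    _ = C₁ ^ (p / q) * ∫⁻ z, ∫⁻ w, h z ^ p * (K z w * ((g w)⁻¹ * f w) ^ p) ∂μ ∂μ := by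
        have e : ∀ z, h z ^ p * ∫⁻ w, K z w * ((g w)⁻¹ * f w) ^ p ∂μ =
            ∫⁻ w, h z ^ p * (K z w * ((g w)⁻¹ * f w) ^ p) ∂μ := fun z => by
          have := hKz z
          rw [lintegral_const_mul _ (by fun_prop)]
        simp only [e]
        rw [lintegral_const_mul _ hm1.lintegral_prod_right']
    _ = C₁ ^ (p / q) * ∫⁻ w, ∫⁻ z, h z ^ p * (K z w * ((g w)⁻¹ * f w) ^ p) ∂μ ∂μ := by
        rw [lintegral_lintegral_swap hm1.aemeasurable]
    _ ≤ C₁ ^ (p / q) * ∫⁻ w, C₂ * f w ^ p ∂μ := by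
        gcongr C₁ ^ (p / q) * ?_
        refine lintegral_mono_ae ?_
        filter_upwards [h2, hg0, hgt] with w hw hw0 hwt
        have := hKw w
        calc ∫⁻ z, h z ^ p * (K z w * ((g w)⁻¹ * f w) ^ p) ∂μ =
              ((g w)⁻¹ * f w) ^ p * ∫⁻ z, K z w * h z ^ p ∂μ := by
              rw [← lintegral_const_mul _ (by fun_prop)]
              refine lintegral_congr fun z => ?_
              ring
          _ ≤ ((g w)⁻¹ * f w) ^ p * (C₂ * g w ^ p) := by gcongr
          _ = C₂ * f w ^ p := by
              rw [mul_left_comm, ← ENNReal.mul_rpow_of_nonneg _ _ hp0.le, mul_right_comm,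
                ENNReal.inv_mul_cancel hw0 hwt, one_mul]
    _ = _ := by
        rw [lintegral_const_mul _ (by fun_prop), mul_assoc]

/-- The weight `(1 - |v|²)^{-t}` on the disc. -/
noncomputable def discWeight (t : ℝ) (v : ℂ) : ℝ≥0∞ := ENNReal.ofReal ((1 - ‖v‖ ^ 2) ^ (-t))

/-- The modulus `|1 - u v̄|^{-2}` of the Bergman kernel of the disc, up to a factor `π`. -/
noncomputable def discKernel (u v : ℂ) : ℝ≥0∞ :=
  ENNReal.ofReal ((‖1 - u * (starRingEnd ℂ) v‖ ^ 2)⁻¹)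

@[fun_prop]
theorem measurable_discWeight (t : ℝ) : Measurable (discWeight t) := by
  unfold discWeight; fun_prop

@[fun_prop]
theorem Measurable.discKernel {α : Type*} [MeasurableSpace α] {f g : α → ℂ} (hf : Measurable f)
    (hg : Measurable g) : Measurable fun x => discKernel (f x) (g x) := by
  have := measurable_conj_complex
  unfold _root_.discKernel
  fun_prop

theorem discKernel_comm (u v : ℂ) : discKernel u v = discKernel v u := by
  unfold discKernel
  rw [← RCLike.norm_conj (1 - u * _)]
  simp [mul_comm]

theorem one_sub_norm_sq_pos {v : ℂ} (hv : ‖v‖ < 1) : 0 < 1 - ‖v‖ ^ 2 := by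
  nlinarith [norm_nonneg v]

theorem discWeight_ne_zero (t : ℝ) {v : ℂ} (hv : ‖v‖ < 1) : discWeight t v ≠ 0 := by
  have := one_sub_norm_sq_pos hv
  unfold discWeight
  rw [ne_eq, ENNReal.ofReal_eq_zero, not_le]
  positivity

theorem discWeight_rpow (t q : ℝ) {v : ℂ} (hv : ‖v‖ < 1) :
    discWeight t v ^ q = discWeight (t * q) v := by
  have := one_sub_norm_sq_pos hv
  unfold discWeight
  rw [ENNReal.ofReal_rpow_of_pos (by positivity), ← Real.rpow_mul this.le, neg_mul]

/-- On `[1/4, 3/4]` the Forelli–Rudin constant satisfies `1/t + 1/(1 - t) ≤ 8`; this range contains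
`1/p` and `1/q` for all `4/3 < p < 4`, so the bound is uniform in `p`. -/
theorem lintegral_discWeight_mul_discKernel_le {u : ℂ} (hu : ‖u‖ < 1) {t : ℝ} (ht0 : 1 / 4 ≤ t)
    (ht1 : t ≤ 3 / 4) :
    ∫⁻ v in ball (0 : ℂ) 1, discWeight t v * discKernel u v ≤
      ENNReal.ofReal (8 * Real.pi) * discWeight t u := by
  refine (lintegral_unitDisc_rpow_mul_kernel_le hu (by linarith) (by linarith)).trans ?_
  have := one_sub_norm_sq_pos hu
  unfold discWeight
  rw [← ENNReal.ofReal_mul (by positivity)]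
  refine ENNReal.ofReal_le_ofReal (mul_le_mul_of_nonneg_right ?_ (by positivity))
  have h1 : 1 / t ≤ 4 := by
    rw [div_le_iff₀ (by linarith)]; linarith
  have h2 : 1 / (1 - t) ≤ 4 := by
    rw [div_le_iff₀ (by linarith)]; linarith
  nlinarith [Real.pi_pos]

/-- The coordinates `(z₁ / z₂, z₂)` separate, with the whole Jacobian in the second one. -/
theorem lintegral_hartogs_mul {φ ψ : ℂ → ℝ≥0∞} (hφ : Measurable φ) (hψ : Measurable ψ) :
    ∫⁻ w, φ (w.1 / w.2) * ψ w.2 ∂hartogsMeasure =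
      (∫⁻ v in ball (0 : ℂ) 1, φ v) * ∫⁻ w in ball (0 : ℂ) 1, ‖w‖ₑ ^ 2 * ψ w := by
  rw [lintegral_hartogsMeasure (by fun_prop),
    ← lintegral_prod_mul (by fun_prop) (by fun_prop)]
  refine lintegral_congr fun x => ?_
  rcases eq_or_ne x.2 0 with h0 | h0
  · simp [h0]
  · simp only [hartogsMap, mul_div_cancel_right₀ _ h0]
    ring

/-- Schur's test on the Hartogs triangle for kernels that are the product of the kernel of the disc
in the variable `z₁ / z₂` and a kernel in `z₂`. -/
theorem lintegral_hartogs_rpow_le_of_schur {p q : ℝ} (hpq : p.HolderConjugate q)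
    (hp : 4 / 3 < p) (hp' : p < 4) {L : ℂ → ℂ → ℝ≥0∞} (hL : Measurable fun x : ℂ × ℂ => L x.1 x.2)
    {a b : ℂ → ℝ≥0∞} (ha : Measurable a) (hb : Measurable b)
    (hb0 : ∀ w, ‖w‖ < 1 → w ≠ 0 → b w ≠ 0) (hbt : ∀ w, b w ≠ ∞) {D₁ D₂ : ℝ≥0∞}
    (h1 : ∀ z, ‖z‖ < 1 → z ≠ 0 →
      ∫⁻ w in ball (0 : ℂ) 1, ‖w‖ₑ ^ 2 * (L z w * b w ^ q) ≤ D₁ * a z ^ q)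
    (h2 : ∀ w, ‖w‖ < 1 → w ≠ 0 →
      ∫⁻ z in ball (0 : ℂ) 1, ‖z‖ₑ ^ 2 * (L z w * a z ^ p) ≤ D₂ * b w ^ p)
    {f : ℂ × ℂ → ℝ≥0∞} (hf : Measurable f) :
    ∫⁻ z, (∫⁻ w, discKernel (z.1 / z.2) (w.1 / w.2) * L z.2 w.2 * f w ∂hartogsMeasure) ^ p
        ∂hartogsMeasure ≤
      (ENNReal.ofReal (8 * Real.pi) * D₁) ^ (p / q) * (ENNReal.ofReal (8 * Real.pi) * D₂) *
        ∫⁻ w, f w ^ p ∂hartogsMeasure := by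
  have hp0 := hpq.pos
  have hq0 := hpq.symm.pos
  have hinv := hpq.inv_add_inv_eq_one
  have hp1 : 1 / 4 ≤ p⁻¹ := by rw [one_div]; exact inv_anti₀ hp0 hp'.le
  have hp2 : p⁻¹ ≤ 3 / 4 := by
    rw [show (3 / 4 : ℝ) = (4 / 3)⁻¹ by norm_num]; exact inv_anti₀ (by norm_num) hp.le
  have hmem : ∀ᵐ z ∂hartogsMeasure, z ∈ hartogsTriangle :=
    ae_restrict_mem isOpen_hartogsTriangle.measurableSet
  -- This exponent makes the weights in the two Schur conditions `s q = 1/p` and `s p = 1/q`, both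
  -- in `[1/4, 3/4]`.
  set s : ℝ := p⁻¹ * q⁻¹ with hs
  have hsq : s * q = p⁻¹ := by rw [hs]; field_simp
  have hsp : s * p = q⁻¹ := by rw [hs]; field_simp
  have hk : ∀ u, Measurable (discKernel u) := fun u =>
    measurable_const.discKernel measurable_id
  have hL1 : ∀ z, Measurable fun w => L z w := fun z => by
    have h : Measurable fun w : ℂ => (z, w) := by fun_prop
    exact hL.comp h
  have hL2 : ∀ w, Measurable fun z => L z w := fun w => by
    have h : Measurable fun z : ℂ => (z, w) := by fun_prop
    exact hL.comp h
  refine lintegral_rpow_le_of_schur (μ := hartogsMeasure) hpq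
    (C₁ := ENNReal.ofReal (8 * Real.pi) * D₁) (C₂ := ENNReal.ofReal (8 * Real.pi) * D₂)
    (K := fun z w => discKernel (z.1 / z.2) (w.1 / w.2) * L z.2 w.2)
    (g := fun w => discWeight s (w.1 / w.2) * b w.2)
    (h := fun z => discWeight s (z.1 / z.2) * a z.2) ?_ hf (by fun_prop) (by fun_prop) ?_ ?_ ?_ ?_
  · refine Measurable.mul ?_ ?_
    · exact Measurable.discKernel (by fun_prop) (by fun_prop)
    · have : Measurable fun x : (ℂ × ℂ) × (ℂ × ℂ) => (x.1.2, x.2.2) := by fun_prop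
      exact hL.comp this
  · filter_upwards [hmem] with w hw
    exact mul_ne_zero (discWeight_ne_zero _ (norm_div_lt_one_of_mem_hartogsTriangle hw))
      (hb0 _ hw.2 (snd_ne_zero_of_mem_hartogsTriangle hw))
  · exact Eventually.of_forall fun w => ENNReal.mul_ne_top ENNReal.ofReal_ne_top (hbt _)
  · filter_upwards [hmem] with z hz
    have hu := norm_div_lt_one_of_mem_hartogsTriangle hz
    have hku := hk (z.1 / z.2)
    have hLz := hL1 z.2
    calc _ = ∫⁻ w, (discWeight p⁻¹ (w.1 / w.2) * discKernel (z.1 / z.2) (w.1 / w.2)) *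
          (L z.2 w.2 * b w.2 ^ q) ∂hartogsMeasure := by
          refine lintegral_congr_ae ?_
          filter_upwards [hmem] with w hw
          rw [ENNReal.mul_rpow_of_nonneg _ _ hq0.le,
            discWeight_rpow _ _ (norm_div_lt_one_of_mem_hartogsTriangle hw), hsq]
          ring
      _ = _ := lintegral_hartogs_mul (φ := fun v => discWeight p⁻¹ v * discKernel (z.1 / z.2) v)
          (ψ := fun w => L z.2 w * b w ^ q) (by fun_prop) (by fun_prop)
      _ ≤ (ENNReal.ofReal (8 * Real.pi) * discWeight p⁻¹ (z.1 / z.2)) * (D₁ * a z.2 ^ q) := by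
          gcongr
          · exact lintegral_discWeight_mul_discKernel_le hu hp1 hp2
          · exact h1 _ hz.2 (snd_ne_zero_of_mem_hartogsTriangle hz)
      _ = _ := by
          rw [ENNReal.mul_rpow_of_nonneg _ _ hq0.le, discWeight_rpow _ _ hu, hsq]
          ring
  · filter_upwards [hmem] with w hw
    have hu := norm_div_lt_one_of_mem_hartogsTriangle hw
    have hku := hk (w.1 / w.2)
    have hLz := hL2 w.2
    calc _ = ∫⁻ z, (discWeight q⁻¹ (z.1 / z.2) * discKernel (w.1 / w.2) (z.1 / z.2)) *
          (L z.2 w.2 * a z.2 ^ p) ∂hartogsMeasure := by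
          refine lintegral_congr_ae ?_
          filter_upwards [hmem] with z hz
          rw [ENNReal.mul_rpow_of_nonneg _ _ hp0.le,
            discWeight_rpow _ _ (norm_div_lt_one_of_mem_hartogsTriangle hz), hsp,
            discKernel_comm]
          ring
      _ = _ := lintegral_hartogs_mul (φ := fun v => discWeight q⁻¹ v * discKernel (w.1 / w.2) v)
          (ψ := fun z => L z w.2 * a z ^ p) (by fun_prop) (by fun_prop)
      _ ≤ (ENNReal.ofReal (8 * Real.pi) * discWeight q⁻¹ (w.1 / w.2)) * (D₂ * b w.2 ^ p) := by
          gcongr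
          · exact lintegral_discWeight_mul_discKernel_le hu (by linarith) (by linarith)
          · exact h2 _ hw.2 (snd_ne_zero_of_mem_hartogsTriangle hw)
      _ = _ := by
          rw [ENNReal.mul_rpow_of_nonneg _ _ hp0.le, discWeight_rpow _ _ hu, hsp]
          ring

/-! ### The two pieces of the kernel and the `L^p` bound. -/

theorem lintegral_unitDisc_rpow_norm {s : ℝ} (hs : s < 4) :
    ∫⁻ w in ball (0 : ℂ) 1, ENNReal.ofReal (‖w‖ ^ (2 - s)) =
      ENNReal.ofReal (2 * Real.pi / (4 - s)) := by
  rw [lintegral_unitDisc_norm (φ := fun r => ENNReal.ofReal (r ^ (2 - s))) (by fun_prop)]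
  have h1 : ∀ r ∈ Set.Ioo (0 : ℝ) 1, ENNReal.ofReal r * ENNReal.ofReal (r ^ (2 - s)) =
      ENNReal.ofReal (r ^ (3 - s)) := fun r hr => by
    rw [← ENNReal.ofReal_mul hr.1.le, show 3 - s = 1 + (2 - s) by ring, Real.rpow_add hr.1,
      Real.rpow_one]
  rw [setLIntegral_congr_fun measurableSet_Ioo h1, lintegral_Ioo_rpow (by linarith),
    ← ENNReal.ofReal_mul (by positivity), show 3 - s + 1 = 4 - s by ring, mul_one_div]

theorem ofReal_norm_rpow_neg_rpow {z : ℂ} (hz : z ≠ 0) {r : ℝ} (s : ℝ) :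
    ENNReal.ofReal (‖z‖ ^ (-s)) ^ r = ENNReal.ofReal (‖z‖ ^ (-(s * r))) := by
  have := norm_pos_iff.2 hz
  rw [ENNReal.ofReal_rpow_of_pos (by positivity), ← Real.rpow_mul this.le, neg_mul]

/-- Since `q/p = q - 1`, the powers of `|w|` combine to `2 - 1 - (q - 1) = 2 - q`, while `|z|⁻¹` is
the `q`-th power of the weight `|z|^(-1/q)`. This choice of weights produces the sharp factor `1/(4
- q)`. -/
theorem lintegral_unitDisc_rank_one {p q : ℝ} (hpq : p.HolderConjugate q) (hq : q < 4) {z : ℂ}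
    (hz : z ≠ 0) :
    ∫⁻ w in ball (0 : ℂ) 1, ‖w‖ₑ ^ 2 * (ENNReal.ofReal ‖z‖⁻¹ * ENNReal.ofReal ‖w‖⁻¹ *
        ENNReal.ofReal (‖w‖ ^ (-p⁻¹)) ^ q) =
      ENNReal.ofReal (2 * Real.pi / (4 - q)) * ENNReal.ofReal (‖z‖ ^ (-q⁻¹)) ^ q := by
  have hq0 := hpq.symm.pos
  have hinv := hpq.inv_add_inv_eq_one
  have e1 : p⁻¹ * q = q - 1 := by
    rw [← eq_sub_iff_add_eq] at hinv
    rw [hinv]; field_simp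
  rw [ofReal_norm_rpow_neg_rpow hz, inv_mul_cancel₀ hq0.ne', Real.rpow_neg_one, mul_comm,
    ← lintegral_unitDisc_rpow_norm hq, ← lintegral_const_mul _ (by fun_prop)]
  refine lintegral_congr_ae (ae_restrict_of_ae ?_)
  filter_upwards [show ∀ᵐ w : ℂ, w ≠ 0 by simp [ae_iff]] with w hw
  have h0 := norm_pos_iff.2 hw
  rw [ofReal_norm_rpow_neg_rpow hw, e1, ← ofReal_norm w, ← ENNReal.ofReal_pow h0.le,
    mul_left_comm (ENNReal.ofReal (‖w‖ ^ 2)), mul_assoc]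
  congr 1
  rw [← ENNReal.ofReal_mul (by positivity), ← ENNReal.ofReal_mul (by positivity)]
  congr 1
  rw [← Real.rpow_neg_one ‖w‖, ← Real.rpow_natCast ‖w‖ 2, ← Real.rpow_add h0, ← Real.rpow_add h0]
  congr 1
  push_cast
  ring

/-- The Jacobian factor `|w|² ≤ 1` is dropped; the regular part of the kernel has no use for it. -/
theorem lintegral_unitDisc_norm_sq_mul_discKernel_le {p q : ℝ} (hpq : p.HolderConjugate q)
    (hp : 4 / 3 < p) (hp' : p < 4) {z : ℂ} (hz : ‖z‖ < 1) :
    ∫⁻ w in ball (0 : ℂ) 1, ‖w‖ₑ ^ 2 * (discKernel z w * discWeight (p⁻¹ * q⁻¹) w ^ q) ≤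
      ENNReal.ofReal (8 * Real.pi) * discWeight (p⁻¹ * q⁻¹) z ^ q := by
  have hp0 := hpq.pos
  have hq0 := hpq.symm.pos
  have hp1 : 1 / 4 ≤ p⁻¹ := by rw [one_div]; exact inv_anti₀ hp0 hp'.le
  have hp2 : p⁻¹ ≤ 3 / 4 := by
    rw [show (3 / 4 : ℝ) = (4 / 3)⁻¹ by norm_num]; exact inv_anti₀ (by norm_num) hp.le
  have hsq : p⁻¹ * q⁻¹ * q = p⁻¹ := by field_simp
  rw [discWeight_rpow _ _ hz, hsq]
  refine le_trans (setLIntegral_mono' measurableSet_ball fun w hw => ?_)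
    (lintegral_discWeight_mul_discKernel_le hz hp1 hp2)
  have hw1 : ‖w‖ < 1 := by simpa using hw
  rw [discWeight_rpow _ _ hw1, hsq, mul_comm (discKernel z w)]
  refine mul_le_of_le_one_left' (pow_le_one' ?_ 2)
  rw [← ofReal_norm]
  exact ENNReal.ofReal_le_one.2 hw1.le

/-- For `x = z₂ w̄₂`, `x⁻¹ (1 - x)⁻² = x⁻¹ + (2 - x)(1 - x)⁻²`, and `|2 - x| ≤ 3`. This isolates the
singularity at `z₂ w̄₂ = 0` from the one at the boundary. -/
theorem enorm_hartogsKernel_le {z w : ℂ × ℂ} (hz : z ∈ hartogsTriangle) (hw : w ∈ hartogsTriangle) :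
    ‖hartogsKernel z w‖ₑ ≤ ENNReal.ofReal ((Real.pi ^ 2)⁻¹) *
      (discKernel (z.1 / z.2) (w.1 / w.2) * (ENNReal.ofReal ‖z.2‖⁻¹ * ENNReal.ofReal ‖w.2‖⁻¹) +
        3 * (discKernel (z.1 / z.2) (w.1 / w.2) * discKernel z.2 w.2)) := by
  have hz0 := snd_ne_zero_of_mem_hartogsTriangle hz
  have hw0 := snd_ne_zero_of_mem_hartogsTriangle hw
  set x := z.2 * (starRingEnd ℂ) w.2 with hx
  have hx1 : ‖x‖ < 1 := norm_mul_conj_lt_one hz.2 hw.2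
  have hx0 : x ≠ 0 := mul_ne_zero hz0 (by simpa using hw0)
  have hxne := one_sub_ne_zero_of_norm_lt hx1
  have hid : x⁻¹ * ((1 - x) ^ 2)⁻¹ = x⁻¹ + (2 - x) * ((1 - x) ^ 2)⁻¹ := by
    field_simp; ring
  have hxn : ‖x‖⁻¹ = ‖z.2‖⁻¹ * ‖w.2‖⁻¹ := by
    rw [hx, norm_mul, RCLike.norm_conj, mul_inv]
  have hreal : ‖x⁻¹ * ((1 - x) ^ 2)⁻¹‖ ≤ ‖z.2‖⁻¹ * ‖w.2‖⁻¹ + 3 * (‖1 - x‖ ^ 2)⁻¹ := by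
    rw [hid, ← hxn]
    refine (norm_add_le _ _).trans ?_
    rw [norm_inv x, norm_mul (2 - x), norm_inv (_ ^ 2), norm_pow]
    gcongr
    refine (norm_sub_le _ _).trans ?_
    have : ‖(2 : ℂ)‖ = 2 := by simp
    linarith
  have hk : ‖hartogsKernel z w‖ ≤ (Real.pi ^ 2)⁻¹ *
      ((‖1 - z.1 / z.2 * (starRingEnd ℂ) (w.1 / w.2)‖ ^ 2)⁻¹ * (‖z.2‖⁻¹ * ‖w.2‖⁻¹) +
        3 * ((‖1 - z.1 / z.2 * (starRingEnd ℂ) (w.1 / w.2)‖ ^ 2)⁻¹ * (‖1 - x‖ ^ 2)⁻¹)) := by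
    unfold hartogsKernel
    rw [← hx, mul_assoc ((Real.pi : ℂ) ^ 2)⁻¹, norm_mul, norm_mul ((Real.pi : ℂ) ^ 2)⁻¹, norm_inv,
      norm_inv (_ ^ 2), norm_pow, norm_pow, Complex.norm_of_nonneg Real.pi_pos.le]
    calc _ ≤ (Real.pi ^ 2)⁻¹ * (‖z.2‖⁻¹ * ‖w.2‖⁻¹ + 3 * (‖1 - x‖ ^ 2)⁻¹) *
          (‖1 - z.1 / z.2 * (starRingEnd ℂ) (w.1 / w.2)‖ ^ 2)⁻¹ := by gcongr
      _ = _ := by ring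
  rw [← ofReal_norm]
  refine (ENNReal.ofReal_le_ofReal hk).trans (le_of_eq ?_)
  unfold discKernel
  rw [ENNReal.ofReal_mul (by positivity), ENNReal.ofReal_add (by positivity) (by positivity),
    ENNReal.ofReal_mul (by positivity), ENNReal.ofReal_mul (by positivity),
    ENNReal.ofReal_mul (by norm_num), ENNReal.ofReal_mul (by positivity), ENNReal.ofReal_ofNat]

theorem rpow_one_div_le_of_le_mul {p q : ℝ} (hpq : p.HolderConjugate q) {I C₁ C₂ J : ℝ≥0∞}
    (h : I ≤ C₁ ^ (p / q) * C₂ * J) :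
    I ^ (1 / p) ≤ C₁ ^ (1 / q) * C₂ ^ (1 / p) * J ^ (1 / p) := by
  have hp0 := hpq.pos
  have hq0 := hpq.symm.pos
  refine (ENNReal.rpow_le_rpow h (by positivity)).trans (le_of_eq ?_)
  rw [ENNReal.mul_rpow_of_nonneg _ _ (by positivity), ENNReal.mul_rpow_of_nonneg _ _ (by positivity),
    ← ENNReal.rpow_mul, show p / q * (1 / p) = 1 / q by field_simp]

theorem lintegral_rpow_const_mul {α : Type*} [MeasurableSpace α] {μ : Measure α} {p : ℝ}
    (hp : 0 < p) (c : ℝ≥0∞) {f : α → ℝ≥0∞} (hf : Measurable f) :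
    (∫⁻ z, (c * f z) ^ p ∂μ) ^ (1 / p) = c * (∫⁻ z, f z ^ p ∂μ) ^ (1 / p) := by
  simp only [ENNReal.mul_rpow_of_nonneg _ _ hp.le]
  rw [lintegral_const_mul _ (by fun_prop), ENNReal.mul_rpow_of_nonneg _ _ (by positivity),
    ← ENNReal.rpow_mul, mul_one_div_cancel hp.ne', ENNReal.rpow_one]

/-- The integral operator on the Hartogs triangle with the Bergman kernel. -/
noncomputable def hartogsIntegral (f : ℂ × ℂ → ℂ) (z : ℂ × ℂ) : ℂ :=
  ∫ w, hartogsKernel z w * f w ∂hartogsMeasure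

theorem aestronglyMeasurable_hartogsIntegral {f : ℂ × ℂ → ℂ}
    (hf : AEStronglyMeasurable f hartogsMeasure) :
    AEStronglyMeasurable (hartogsIntegral f) hartogsMeasure :=
  (measurable_hartogsKernel.aestronglyMeasurable.mul hf.comp_snd).integral_prod_right'

/-- The Schur constants are `16π²/(4 - q)` and `16π²/(4 - p)`, taken to the powers `1/q` and `1/p`;
these exponents add to `1`, so `16π²` comes out once. -/
theorem lintegral_hartogs_singular_part_le {p q : ℝ} (hpq : p.HolderConjugate q)
    (hp : 4 / 3 < p) (hp' : p < 4) (hq' : q < 4) {f : ℂ × ℂ → ℝ≥0∞} (hf : Measurable f) :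
    (∫⁻ z, (∫⁻ w, discKernel (z.1 / z.2) (w.1 / w.2) *
        (ENNReal.ofReal ‖z.2‖⁻¹ * ENNReal.ofReal ‖w.2‖⁻¹) * f w ∂hartogsMeasure) ^ p
        ∂hartogsMeasure) ^ (1 / p) ≤
      ENNReal.ofReal (16 * Real.pi ^ 2 * ((4 - p) ^ (-(1 / p)) * (4 - q) ^ (-(1 / q)))) *
        (∫⁻ w, f w ^ p ∂hartogsMeasure) ^ (1 / p) := by
  have hp0 := hpq.pos
  have hq0 := hpq.symm.pos
  have h := rpow_one_div_le_of_le_mul hpq (lintegral_hartogs_rpow_le_of_schur hpq hp hp'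
    (L := fun z w => ENNReal.ofReal ‖z‖⁻¹ * ENNReal.ofReal ‖w‖⁻¹)
    (a := fun z => ENNReal.ofReal (‖z‖ ^ (-q⁻¹))) (b := fun w => ENNReal.ofReal (‖w‖ ^ (-p⁻¹)))
    (D₁ := ENNReal.ofReal (2 * Real.pi / (4 - q))) (D₂ := ENNReal.ofReal (2 * Real.pi / (4 - p)))
    (by fun_prop) (by fun_prop) (by fun_prop) ?_ (fun w => ENNReal.ofReal_ne_top) ?_ ?_ hf)
  · refine h.trans (le_of_eq ?_)
    congr 1
    have h4p : 0 < 4 - p := by linarith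
    have h4q : 0 < 4 - q := by linarith
    have hpi := Real.pi_pos
    rw [← ENNReal.ofReal_mul (by positivity), ← ENNReal.ofReal_mul (by positivity),
      ENNReal.ofReal_rpow_of_pos (by positivity), ENNReal.ofReal_rpow_of_pos (by positivity),
      ← ENNReal.ofReal_mul (by positivity)]
    congr 1
    have e : ∀ x : ℝ, 8 * Real.pi * (2 * Real.pi / x) = (16 * Real.pi ^ 2) * x⁻¹ := fun x => by
      ring
    rw [e, e, Real.mul_rpow (x := 16 * Real.pi ^ 2) (by positivity) (by positivity),
      Real.mul_rpow (x := 16 * Real.pi ^ 2) (by positivity) (by positivity), Real.inv_rpow h4p.le, Real.inv_rpow h4q.le,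
      ← Real.rpow_neg h4p.le, ← Real.rpow_neg h4q.le]
    have e2 : (16 * Real.pi ^ 2) ^ (1 / q) * (16 * Real.pi ^ 2) ^ (1 / p) = 16 * Real.pi ^ 2 := by
      rw [← Real.rpow_add (by positivity), one_div, one_div, add_comm, hpq.inv_add_inv_eq_one,
        Real.rpow_one]
    linear_combination ((4 - p) ^ (-(1 / p)) * (4 - q) ^ (-(1 / q))) * e2
  · intro w _ hw0
    have := norm_pos_iff.2 hw0
    rw [ne_eq, ENNReal.ofReal_eq_zero, not_le]
    positivity
  · exact fun z _ hz0 => (lintegral_unitDisc_rank_one hpq hq' hz0).le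
  · intro w _ hw0
    refine le_trans (le_of_eq ?_) (lintegral_unitDisc_rank_one hpq.symm hp' hw0).le
    simp only [mul_comm (ENNReal.ofReal ‖w‖⁻¹)]

theorem lintegral_hartogs_regular_part_le {p q : ℝ} (hpq : p.HolderConjugate q)
    (hp : 4 / 3 < p) (hp' : p < 4) (hq : 4 / 3 < q) (hq' : q < 4) {f : ℂ × ℂ → ℝ≥0∞}
    (hf : Measurable f) :
    (∫⁻ z, (∫⁻ w, discKernel (z.1 / z.2) (w.1 / w.2) * discKernel z.2 w.2 * f w
        ∂hartogsMeasure) ^ p ∂hartogsMeasure) ^ (1 / p) ≤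
      ENNReal.ofReal (64 * Real.pi ^ 2) * (∫⁻ w, f w ^ p ∂hartogsMeasure) ^ (1 / p) := by
  have h := rpow_one_div_le_of_le_mul hpq (lintegral_hartogs_rpow_le_of_schur hpq hp hp'
    (L := discKernel) (a := discWeight (p⁻¹ * q⁻¹)) (b := discWeight (p⁻¹ * q⁻¹))
    (D₁ := ENNReal.ofReal (8 * Real.pi)) (D₂ := ENNReal.ofReal (8 * Real.pi))
    (by fun_prop) (by fun_prop) (by fun_prop) (fun w hw _ => discWeight_ne_zero _ hw)
    (fun w => ENNReal.ofReal_ne_top)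
    (fun z hz _ => lintegral_unitDisc_norm_sq_mul_discKernel_le hpq hp hp' hz) ?_ hf)
  · refine h.trans (le_of_eq ?_)
    congr 1
    rw [← ENNReal.rpow_add_of_nonneg _ _ (one_div_nonneg.2 hpq.symm.nonneg)
        (one_div_nonneg.2 hpq.nonneg), one_div, one_div, add_comm, hpq.inv_add_inv_eq_one,
      ENNReal.rpow_one, ← ENNReal.ofReal_mul (by positivity)]
    congr 1
    ring
  · intro w hw _
    rw [mul_comm p⁻¹ q⁻¹]
    simp only [discKernel_comm _ w]
    exact lintegral_unitDisc_norm_sq_mul_discKernel_le hpq.symm hq hq' hw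

/-- Minkowski's inequality adds the two parts. The factor `π⁻²` of the kernel turns `16π²` into `16`
and `3 · 64π²` into `192`. -/
theorem eLpNorm_hartogsIntegral_le {p q : ℝ} (hpq : p.HolderConjugate q)
    (hp : 4 / 3 < p) (hp' : p < 4) (hq : 4 / 3 < q) (hq' : q < 4) {f : ℂ × ℂ → ℂ}
    (hf : AEStronglyMeasurable f hartogsMeasure) :
    eLpNorm (hartogsIntegral f) (ENNReal.ofReal p) hartogsMeasure ≤
      ENNReal.ofReal (16 * ((4 - p) ^ (-(1 / p)) * (4 - q) ^ (-(1 / q))) + 192) *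
        eLpNorm f (ENNReal.ofReal p) hartogsMeasure := by
  have hp0 := hpq.pos
  have hmem : ∀ᵐ z ∂hartogsMeasure, z ∈ hartogsTriangle :=
    ae_restrict_mem isOpen_hartogsTriangle.measurableSet
  set F : ℂ × ℂ → ℝ≥0∞ := fun w => ‖hf.mk f w‖ₑ with hF
  have hFm : Measurable F := hf.stronglyMeasurable_mk.measurable.enorm
  have hFf : ∀ᵐ w ∂hartogsMeasure, ‖f w‖ₑ = F w := hf.ae_eq_mk.mono fun w hw => by rw [hw]
  set A : ℂ × ℂ → ℝ≥0∞ := fun z => ∫⁻ w, discKernel (z.1 / z.2) (w.1 / w.2) *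
    (ENNReal.ofReal ‖z.2‖⁻¹ * ENNReal.ofReal ‖w.2‖⁻¹) * F w ∂hartogsMeasure with hA
  set B : ℂ × ℂ → ℝ≥0∞ := fun z => ∫⁻ w, discKernel (z.1 / z.2) (w.1 / w.2) *
    discKernel z.2 w.2 * F w ∂hartogsMeasure with hB
  have hAm : Measurable A := Measurable.lintegral_prod_right' (ν := hartogsMeasure)
    (f := fun x : (ℂ × ℂ) × (ℂ × ℂ) => discKernel (x.1.1 / x.1.2) (x.2.1 / x.2.2) *
      (ENNReal.ofReal ‖x.1.2‖⁻¹ * ENNReal.ofReal ‖x.2.2‖⁻¹) * F x.2) (by fun_prop)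
  have hBm : Measurable B := Measurable.lintegral_prod_right' (ν := hartogsMeasure)
    (f := fun x : (ℂ × ℂ) × (ℂ × ℂ) => discKernel (x.1.1 / x.1.2) (x.2.1 / x.2.2) *
      discKernel x.1.2 x.2.2 * F x.2) (by fun_prop)
  set c : ℝ≥0∞ := ENNReal.ofReal ((Real.pi ^ 2)⁻¹) with hc
  have hpt : ∀ᵐ z ∂hartogsMeasure, ‖hartogsIntegral f z‖ₑ ≤ c * A z + c * 3 * B z := by
    filter_upwards [hmem] with z hz
    have hm1 : Measurable fun w : ℂ × ℂ => discKernel (z.1 / z.2) (w.1 / w.2) *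
      (ENNReal.ofReal ‖z.2‖⁻¹ * ENNReal.ofReal ‖w.2‖⁻¹) * F w := by fun_prop
    have hm2 : Measurable fun w : ℂ × ℂ => discKernel (z.1 / z.2) (w.1 / w.2) *
      discKernel z.2 w.2 * F w := by fun_prop
    calc ‖hartogsIntegral f z‖ₑ ≤ ∫⁻ w, ‖hartogsKernel z w * f w‖ₑ ∂hartogsMeasure :=
          enorm_integral_le_lintegral_enorm _
      _ ≤ ∫⁻ w, (c * (discKernel (z.1 / z.2) (w.1 / w.2) *
            (ENNReal.ofReal ‖z.2‖⁻¹ * ENNReal.ofReal ‖w.2‖⁻¹) * F w) +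
            c * 3 * (discKernel (z.1 / z.2) (w.1 / w.2) * discKernel z.2 w.2 * F w))
            ∂hartogsMeasure := by
          refine lintegral_mono_ae ?_
          filter_upwards [hmem, hFf] with w hw hw2
          rw [enorm_mul, hw2]
          refine (mul_le_mul_left (enorm_hartogsKernel_le hz hw) _).trans (le_of_eq ?_)
          ring
      _ = _ := by
          rw [lintegral_add_left (by fun_prop), lintegral_const_mul _ hm1,
            lintegral_const_mul _ hm2]
  rw [eLpNorm_eq_lintegral_rpow_enorm_toReal (by simpa using hp0) ENNReal.ofReal_ne_top,
    eLpNorm_eq_lintegral_rpow_enorm_toReal (by simpa using hp0) ENNReal.ofReal_ne_top,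
    ENNReal.toReal_ofReal hp0.le, lintegral_congr_ae (f := fun w => ‖f w‖ₑ ^ p)
      (g := fun w => F w ^ p) (hFf.mono fun w hw => by simp only [hw])]
  calc _ ≤ (∫⁻ z, ((fun z => c * A z) + fun z => c * 3 * B z) z ^ p ∂hartogsMeasure) ^ (1 / p) := by
        refine ENNReal.rpow_le_rpow (lintegral_mono_ae ?_) (by positivity)
        exact hpt.mono fun z hz => ENNReal.rpow_le_rpow hz hp0.le
    _ ≤ _ := ENNReal.lintegral_Lp_add_le (by fun_prop) (by fun_prop) hpq.lt.le
    _ = c * (∫⁻ z, A z ^ p ∂hartogsMeasure) ^ (1 / p) +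
          c * 3 * (∫⁻ z, B z ^ p ∂hartogsMeasure) ^ (1 / p) := by
        rw [lintegral_rpow_const_mul hp0 _ hAm, lintegral_rpow_const_mul hp0 _ hBm]
    _ ≤ c * (ENNReal.ofReal (16 * Real.pi ^ 2 * ((4 - p) ^ (-(1 / p)) * (4 - q) ^ (-(1 / q)))) *
          (∫⁻ w, F w ^ p ∂hartogsMeasure) ^ (1 / p)) +
          c * 3 * (ENNReal.ofReal (64 * Real.pi ^ 2) *
            (∫⁻ w, F w ^ p ∂hartogsMeasure) ^ (1 / p)) := by
        gcongr
        · exact lintegral_hartogs_singular_part_le hpq hp hp' hq' hFm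
        · exact lintegral_hartogs_regular_part_le hpq hp hp' hq hq' hFm
    _ = _ := by
        rw [← mul_assoc c, ← mul_assoc (c * 3), ← add_mul]
        congr 1
        have h4p : 0 < 4 - p := by linarith
        have h4q : 0 < 4 - q := by linarith
        rw [hc, ← ENNReal.ofReal_mul (by positivity), ← ENNReal.ofReal_ofNat 3,
          ← ENNReal.ofReal_mul (by positivity), ← ENNReal.ofReal_mul (by positivity),
          ← ENNReal.ofReal_add (by positivity) (by positivity)]
        congr 1
        have := Real.pi_ne_zero
        field_simp
        norm_num

/-! ### The bounded operator on `L^p` and its uniqueness. -/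

/-- Hölder, with the kernel in `L^q`. This makes the integral operator linear on all of `L^p`, not
only on `L² ∩ L^p`. -/
theorem integrable_hartogsKernel_mul {p q : ℝ} (hpq : p.HolderConjugate q) (hq : q < 4)
    {z : ℂ × ℂ} (hz : z ∈ hartogsTriangle) {f : ℂ × ℂ → ℂ}
    (hf : MemLp f (ENNReal.ofReal p) hartogsMeasure) :
    Integrable (fun w => hartogsKernel z w * f w) hartogsMeasure := by
  have : ENNReal.HolderConjugate (ENNReal.ofReal q) (ENNReal.ofReal p) :=
    hpq.symm.ennrealOfReal
  exact (memLp_hartogsKernel hz hpq.symm.pos hq).integrable_mul hf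

theorem hartogsIntegral_congr_ae {f g : ℂ × ℂ → ℂ} (h : f =ᵐ[hartogsMeasure] g) :
    hartogsIntegral f = hartogsIntegral g := by
  ext z
  exact integral_congr_ae (h.mono fun w hw => by simp only [hw])

theorem memLp_hartogsIntegral {p q : ℝ} (hpq : p.HolderConjugate q)
    (hp : 4 / 3 < p) (hp' : p < 4) (hq : 4 / 3 < q) (hq' : q < 4) {f : ℂ × ℂ → ℂ}
    (hf : MemLp f (ENNReal.ofReal p) hartogsMeasure) :
    MemLp (hartogsIntegral f) (ENNReal.ofReal p) hartogsMeasure :=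
  ⟨aestronglyMeasurable_hartogsIntegral hf.1,
    (eLpNorm_hartogsIntegral_le hpq hp hp' hq hq' hf.1).trans_lt
      (ENNReal.mul_lt_top ENNReal.ofReal_lt_top hf.2)⟩

theorem exists_hartogsIntegral_operator {p q : ℝ} [Fact (1 ≤ ENNReal.ofReal p)]
    (hpq : p.HolderConjugate q)
    (hp : 4 / 3 < p) (hp' : p < 4) (hq : 4 / 3 < q) (hq' : q < 4) :
    ∃ T : Lp ℂ (ENNReal.ofReal p) hartogsMeasure →L[ℂ] Lp ℂ (ENNReal.ofReal p) hartogsMeasure,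
      (∀ g, T g =ᵐ[hartogsMeasure] hartogsIntegral g) ∧
        ‖T‖ ≤ 16 * ((4 - p) ^ (-(1 / p)) * (4 - q) ^ (-(1 / q))) + 192 := by
  have hmem : ∀ᵐ z ∂hartogsMeasure, z ∈ hartogsTriangle :=
    ae_restrict_mem isOpen_hartogsTriangle.measurableSet
  have hM : ∀ g : Lp ℂ (ENNReal.ofReal p) hartogsMeasure,
      MemLp (hartogsIntegral g) (ENNReal.ofReal p) hartogsMeasure := fun g =>
    memLp_hartogsIntegral hpq hp hp' hq hq' (Lp.memLp g)
  have h4p : 0 < 4 - p := by linarith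
  have h4q : 0 < 4 - q := by linarith
  have hC : 0 ≤ 16 * ((4 - p) ^ (-(1 / p)) * (4 - q) ^ (-(1 / q))) + 192 := by positivity
  let T₀ : Lp ℂ (ENNReal.ofReal p) hartogsMeasure →ₗ[ℂ] Lp ℂ (ENNReal.ofReal p) hartogsMeasure :=
    { toFun := fun g => (hM g).toLp
      map_add' := fun g₁ g₂ => by
        refine Lp.ext ?_
        filter_upwards [(hM (g₁ + g₂)).coeFn_toLp, (hM g₁).coeFn_toLp, (hM g₂).coeFn_toLp,
          Lp.coeFn_add (hM g₁).toLp (hM g₂).toLp, hmem] with z h1 h2 h3 h4 hz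
        rw [h1, h4, Pi.add_apply, h2, h3, hartogsIntegral_congr_ae (Lp.coeFn_add g₁ g₂)]
        unfold hartogsIntegral
        rw [← integral_add (integrable_hartogsKernel_mul hpq hq' hz (Lp.memLp g₁))
          (integrable_hartogsKernel_mul hpq hq' hz (Lp.memLp g₂))]
        simp only [Pi.add_apply, mul_add]
      map_smul' := fun c g => by
        refine Lp.ext ?_
        filter_upwards [(hM (c • g)).coeFn_toLp, (hM g).coeFn_toLp,
          Lp.coeFn_smul c (hM g).toLp] with z h1 h2 h3
        rw [h1, RingHom.id_apply, h3, Pi.smul_apply, h2,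
          hartogsIntegral_congr_ae (Lp.coeFn_smul c g)]
        unfold hartogsIntegral
        rw [smul_eq_mul, ← integral_const_mul]
        simp only [Pi.smul_apply, smul_eq_mul, mul_left_comm] }
  refine ⟨T₀.mkContinuous _ fun g => ?_, fun g => (hM g).coeFn_toLp,
    T₀.mkContinuous_norm_le hC _⟩
  have h := eLpNorm_hartogsIntegral_le hpq hp hp' hq hq' (Lp.memLp g).1
  have h2 := ENNReal.toReal_mono
    (ENNReal.mul_ne_top ENNReal.ofReal_ne_top (Lp.memLp g).2.ne) h
  rw [ENNReal.toReal_mul, ENNReal.toReal_ofReal hC] at h2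
  rw [Lp.norm_def g]
  refine le_trans (le_of_eq ?_) h2
  exact Lp.norm_toLp _ (hM g)

theorem isBergmanProjectionOnLp_of_ae_eq {p : ℝ≥0∞} [Fact (1 ≤ p)]
    {T : Lp ℂ p hartogsMeasure →L[ℂ] Lp ℂ p hartogsMeasure}
    (hT : ∀ g, T g =ᵐ[hartogsMeasure] hartogsIntegral g) : IsBergmanProjectionOnLp p T := by
  intro f g hfg
  refine (hT g).trans ?_
  rw [← hartogsIntegral_congr_ae hfg]
  exact (bergmanProjection_ae_eq f).symm

theorem IsBergmanProjectionOnLp.ae_eq_hartogsIntegral {p : ℝ≥0∞} [Fact (1 ≤ p)]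
    {T : Lp ℂ p hartogsMeasure →L[ℂ] Lp ℂ p hartogsMeasure} (hT : IsBergmanProjectionOnLp p T)
    {f : ℂ × ℂ → ℂ} (hf : MemLp f 2 hartogsMeasure) (hfp : MemLp f p hartogsMeasure) :
    T hfp.toLp =ᵐ[hartogsMeasure] hartogsIntegral f := by
  refine (hT hf.toLp hfp.toLp (hf.coeFn_toLp.trans hfp.coeFn_toLp.symm)).trans ?_
  rw [← hartogsIntegral_congr_ae hf.coeFn_toLp]
  exact bergmanProjection_ae_eq _

/-- Simple functions are dense in `L^p` for `p < ∞`, and they lie in `L²` because the measure is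
finite. -/
theorem IsBergmanProjectionOnLp.unique {p : ℝ≥0∞} [Fact (1 ≤ p)] (hp : p ≠ ∞)
    {T S : Lp ℂ p hartogsMeasure →L[ℂ] Lp ℂ p hartogsMeasure} (hT : IsBergmanProjectionOnLp p T)
    (hS : IsBergmanProjectionOnLp p S) : T = S := by
  refine ContinuousLinearMap.coeFn_injective
    ((Lp.simpleFunc.denseRange hp).equalizer T.continuous S.continuous (funext fun s => ?_))
  simp only [Function.comp]
  have h2 : MemLp (s : Lp ℂ p hartogsMeasure) 2 hartogsMeasure :=
    ((Lp.simpleFunc.toSimpleFunc s).memLp_of_isFiniteMeasure 2 _).ae_eq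
      (Lp.simpleFunc.toSimpleFunc_eq_toFun s)
  refine Lp.ext ?_
  have hTs := hT.ae_eq_hartogsIntegral h2 (Lp.memLp _)
  have hSs := hS.ae_eq_hartogsIntegral h2 (Lp.memLp _)
  rw [Lp.toLp_coeFn] at hTs hSs
  exact hTs.trans hSs.symm

/-! ### The test functions. -/

/-- After the change of variables the integrand is the radial `φ(|x₂|)|x₂|²` against the bidisc
kernel. Both kernel factors average to constants, so only the prefactor `1/z₂` survives. -/
theorem hartogsIntegral_radial {φ : ℝ → ℝ} (hφ : Measurable φ)
    (hi : IntegrableOn (fun w : ℂ => ((φ ‖w‖ * ‖w‖ ^ 2 : ℝ) : ℂ)) (ball 0 1)) {z : ℂ × ℂ}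
    (hz : z ∈ hartogsTriangle) :
    hartogsIntegral (fun w => (φ ‖w.2‖ : ℂ) * (starRingEnd ℂ) w.2) z =
      ((2 * ∫ r in Set.Ioo (0 : ℝ) 1, r * (φ r * r ^ 2) : ℝ) : ℂ) * z.2⁻¹ := by
  have hconj := measurable_conj_complex
  have h1 := integral_unitDisc_radial_mul_kernel (φ := fun r => φ r * r ^ 2) (by fun_prop) hi hz.2
  have h2 := integral_unitDisc_kernel (norm_div_lt_one_of_mem_hartogsTriangle hz)
  have h3 := integral_prod_mul (μ := volume.restrict (ball (0 : ℂ) 1))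
    (ν := volume.restrict (ball (0 : ℂ) 1))
    (fun v => ((1 - z.1 / z.2 * (starRingEnd ℂ) v) ^ 2)⁻¹)
    (fun w => ((φ ‖w‖ * ‖w‖ ^ 2 : ℝ) : ℂ) / (1 - z.2 * (starRingEnd ℂ) w) ^ 2)
  rw [h1, h2] at h3
  unfold hartogsIntegral
  rw [integral_hartogsKernel_mul (by
    have : Measurable fun w : ℂ × ℂ => (φ ‖w.2‖ : ℂ) * (starRingEnd ℂ) w.2 := by fun_prop
    exact this.aestronglyMeasurable)]
  have h4 : ∀ x : ℂ × ℂ, x.2 * ((φ ‖(hartogsMap x).2‖ : ℂ) * (starRingEnd ℂ) (hartogsMap x).2) *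
        ((1 - z.2 * (starRingEnd ℂ) x.2) ^ 2)⁻¹ *
        ((1 - z.1 / z.2 * (starRingEnd ℂ) x.1) ^ 2)⁻¹ =
      ((1 - z.1 / z.2 * (starRingEnd ℂ) x.1) ^ 2)⁻¹ *
        (((φ ‖x.2‖ * ‖x.2‖ ^ 2 : ℝ) : ℂ) / (1 - z.2 * (starRingEnd ℂ) x.2) ^ 2) := by
    intro x
    have h5 : ((‖x.2‖ : ℂ)) ^ 2 = x.2 * (starRingEnd ℂ) x.2 := by
      rw [Complex.mul_conj, Complex.normSq_eq_norm_sq]; push_cast; rfl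
    push_cast
    rw [h5]
    simp only [hartogsMap]
    ring
  simp only [h4]
  rw [h3]
  have : (Real.pi : ℂ) ≠ 0 := by exact_mod_cast Real.pi_ne_zero
  push_cast
  field_simp

theorem eLpNorm_inv_snd {p : ℝ} (hp0 : 0 < p) (hp : p < 4) :
    eLpNorm (fun z : ℂ × ℂ => z.2⁻¹) (ENNReal.ofReal p) hartogsMeasure =
      ENNReal.ofReal ((2 * Real.pi ^ 2 / (4 - p)) ^ (1 / p)) := by
  have h4p : 0 < 4 - p := by linarith
  rw [eLpNorm_eq_lintegral_rpow_enorm_toReal (by simpa using hp0) ENNReal.ofReal_ne_top,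
    ENNReal.toReal_ofReal hp0.le, ← ENNReal.ofReal_rpow_of_pos (by positivity),
    ← lintegral_hartogs_rpow_norm_snd hp]
  congr 1
  refine lintegral_congr_ae ?_
  filter_upwards [ae_restrict_mem isOpen_hartogsTriangle.measurableSet] with z hz
  have h0 := norm_pos_iff.2 (snd_ne_zero_of_mem_hartogsTriangle hz)
  rw [← ofReal_norm, ENNReal.ofReal_rpow_of_pos (by rw [norm_inv]; positivity), norm_inv,
    Real.inv_rpow h0.le, Real.rpow_neg h0.le]

/-- Since `pq = p + q`, `|f|^p = |z₂|^((1 - q)p) = |z₂|^(-q)`. -/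
theorem eLpNorm_hartogsTestFunction {p q : ℝ} (hpq : p.HolderConjugate q) (hq : q < 4) :
    eLpNorm (hartogsTestFunction q) (ENNReal.ofReal p) hartogsMeasure =
      ENNReal.ofReal ((2 * Real.pi ^ 2 / (4 - q)) ^ (1 / p)) := by
  have h4q : 0 < 4 - q := by linarith
  have hp0 := hpq.pos
  rw [eLpNorm_eq_lintegral_rpow_enorm_toReal (by simpa using hp0) ENNReal.ofReal_ne_top,
    ENNReal.toReal_ofReal hp0.le, ← ENNReal.ofReal_rpow_of_pos (by positivity),
    ← lintegral_hartogs_rpow_norm_snd hq]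
  congr 1
  refine lintegral_congr_ae ?_
  filter_upwards [ae_restrict_mem isOpen_hartogsTriangle.measurableSet] with z hz
  have h0 := norm_pos_iff.2 (snd_ne_zero_of_mem_hartogsTriangle hz)
  have h1 : ‖hartogsTestFunction q z‖ = ‖z.2‖ ^ (1 - q) := by
    unfold hartogsTestFunction
    rw [norm_mul, RCLike.norm_conj, Complex.norm_of_nonneg (by positivity),
      ← Real.rpow_add_one h0.ne', neg_add_eq_sub]
  rw [← ofReal_norm, h1, ENNReal.ofReal_rpow_of_pos (by positivity), ← Real.rpow_mul h0.le]
  congr 2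
  have := hpq.mul_eq_add
  linarith

theorem memLp_hartogsTestFunction {p q : ℝ} (hpq : p.HolderConjugate q) (hq : q < 4) :
    MemLp (hartogsTestFunction q) (ENNReal.ofReal p) hartogsMeasure := by
  refine ⟨?_, by rw [eLpNorm_hartogsTestFunction hpq hq]; exact ENNReal.ofReal_lt_top⟩
  have := measurable_conj_complex
  have h : Measurable (hartogsTestFunction q) := by
    unfold hartogsTestFunction; fun_prop
  exact h.aestronglyMeasurable

theorem hartogsIntegral_hartogsTestFunction {q : ℝ} (hq : q < 4) {z : ℂ × ℂ}
    (hz : z ∈ hartogsTriangle) :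
    hartogsIntegral (hartogsTestFunction q) z = ((2 / (4 - q) : ℝ) : ℂ) * z.2⁻¹ := by
  have h4q : 0 < 4 - q := by linarith
  have hint : IntegrableOn (fun w : ℂ => ((‖w‖ ^ (-q) * ‖w‖ ^ 2 : ℝ) : ℂ)) (ball 0 1) := by
    refine ⟨by
      have : Measurable fun w : ℂ => ((‖w‖ ^ (-q) * ‖w‖ ^ 2 : ℝ) : ℂ) := by fun_prop
      exact this.aestronglyMeasurable, ?_⟩
    rw [hasFiniteIntegral_iff_enorm, lintegral_congr_ae (g := fun w =>
      ENNReal.ofReal (‖w‖ ^ (2 - q))), lintegral_unitDisc_rpow_norm hq]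
    · exact ENNReal.ofReal_lt_top
    · refine ae_restrict_of_ae ?_
      filter_upwards [show ∀ᵐ w : ℂ, w ≠ 0 by simp [ae_iff]] with w hw
      have h0 := norm_pos_iff.2 hw
      rw [← ofReal_norm, Complex.norm_of_nonneg (by positivity), ← Real.rpow_natCast,
        ← Real.rpow_add h0]
      congr 2
      push_cast
      ring
  rw [show hartogsTestFunction q = fun w => ((‖w.2‖ ^ (-q) : ℝ) : ℂ) * (starRingEnd ℂ) w.2 from rfl,
    hartogsIntegral_radial (φ := fun r => r ^ (-q)) (by fun_prop) hint hz]
  congr 2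
  have h1 : ∀ r ∈ Set.Ioo (0 : ℝ) 1, r * (r ^ (-q) * r ^ 2) = r ^ (3 - q) := fun r hr => by
    rw [← Real.rpow_natCast, ← Real.rpow_add hr.1, mul_comm, ← Real.rpow_add_one hr.1.ne']
    congr 1; push_cast; ring
  rw [setIntegral_congr_fun measurableSet_Ioo h1, ← integral_Ioc_eq_integral_Ioo,
    ← intervalIntegral.integral_of_le zero_le_one, integral_rpow (Or.inl (by linarith)),
    show 3 - q + 1 = 4 - q by ring, Real.one_rpow, Real.zero_rpow h4q.ne', sub_zero, mul_one_div]

/-! ### Comparison of constants. -/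

theorem Real.HolderConjugate.bounds {p q : ℝ} (hpq : p.HolderConjugate q) (hp : 4 / 3 < p)
    (hp' : p < 4) : 4 / 3 < q ∧ q < 4 := by
  have h1 : 0 < p - 1 := by linarith
  rw [hpq.conjugate_eq, lt_div_iff₀ h1, div_lt_iff₀ h1]
  constructor <;> linarith

/-- Conjugacy gives `4 - q = (3p - 4)/(p - 1)`; the extra power of `p - 1` is harmless because `1/3
< p - 1 < 3`. -/
theorem sub_conj_rpow_eq {p q : ℝ} (hpq : p.HolderConjugate q) (hp : 4 / 3 < p) (s : ℝ) :
    (4 - q) ^ (-s) = (3 * p - 4) ^ (-s) * (p - 1) ^ s := by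
  have h1 : 0 < p - 1 := by linarith
  have h2 : 0 < 3 * p - 4 := by linarith
  have h3 : 4 - q = (3 * p - 4) / (p - 1) := by
    rw [hpq.conjugate_eq]; field_simp; ring
  rw [h3, Real.div_rpow h2.le h1.le, Real.rpow_neg h1.le, div_inv_eq_mul]

theorem rpow_mem_Icc_of_mem {x s : ℝ} (hx : 1 / 3 < x) (hx' : x < 3) (hs0 : 0 ≤ s) (hs : s ≤ 1) :
    1 / 3 ≤ x ^ s ∧ x ^ s ≤ 3 := by
  have hx0 : 0 < x := by linarith
  rcases le_total x 1 with h | h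
  · refine ⟨?_, (Real.rpow_le_one hx0.le h hs0).trans (by norm_num)⟩
    have := Real.rpow_le_rpow_of_exponent_ge hx0 h hs
    rw [Real.rpow_one] at this
    linarith
  · refine ⟨le_trans (by norm_num) (Real.one_le_rpow h hs0), ?_⟩
    have := Real.rpow_le_rpow_of_exponent_le h hs
    rw [Real.rpow_one] at this
    linarith

theorem one_div_mem_Icc {p q : ℝ} (hpq : p.HolderConjugate q) : 0 ≤ 1 / p ∧ 1 / p ≤ 1 := by
  have h0 := hpq.pos
  exact ⟨by positivity, by rw [div_le_one h0]; exact hpq.lt.le⟩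

theorem conj_bounds_comparable {p q : ℝ} (hpq : p.HolderConjugate q) (hp : 4 / 3 < p)
    (hp' : p < 4) :
    1 / 3 * ((4 - p) ^ (-(1 / p)) * (3 * p - 4) ^ (-(1 / q))) ≤
        (4 - p) ^ (-(1 / p)) * (4 - q) ^ (-(1 / q)) ∧
      (4 - p) ^ (-(1 / p)) * (4 - q) ^ (-(1 / q)) ≤
        3 * ((4 - p) ^ (-(1 / p)) * (3 * p - 4) ^ (-(1 / q))) := by
  have h4p : 0 < 4 - p := by linarith
  have h2 : 0 < 3 * p - 4 := by linarith
  obtain ⟨h5, h6⟩ := one_div_mem_Icc hpq.symm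
  obtain ⟨h7, h8⟩ := rpow_mem_Icc_of_mem (x := p - 1) (by linarith) (by linarith) h5 h6
  rw [sub_conj_rpow_eq hpq hp]
  have hY : 0 ≤ (4 - p) ^ (-(1 / p)) * (3 * p - 4) ^ (-(1 / q)) := by positivity
  constructor <;> nlinarith

/-- Both `4 - p` and `3p - 4` are at most `8`, and the exponents add to `-1`. This lets the additive
constant of the operator bound be absorbed. -/
theorem one_eighth_le {p q : ℝ} (hpq : p.HolderConjugate q) (hp : 4 / 3 < p) (hp' : p < 4) :
    1 / 8 ≤ (4 - p) ^ (-(1 / p)) * (3 * p - 4) ^ (-(1 / q)) := by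
  have h4p : 0 < 4 - p := by linarith
  have h2 : 0 < 3 * p - 4 := by linarith
  have h5 := (one_div_mem_Icc hpq).1
  have h6 := (one_div_mem_Icc hpq.symm).1
  calc (1 / 8 : ℝ) = 8 ^ (-(1 / p)) * 8 ^ (-(1 / q)) := by
        rw [← Real.rpow_add (by norm_num), ← neg_add, one_div p, one_div q, hpq.inv_add_inv_eq_one,
          Real.rpow_neg_one]
        norm_num
    _ ≤ _ := by
        refine mul_le_mul ?_ ?_ (by positivity) (by positivity)
        · exact Real.rpow_le_rpow_of_nonpos h4p (by linarith) (by linarith)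
        · exact Real.rpow_le_rpow_of_nonpos h2 (by linarith) (by linarith)

theorem exists_bergmanProjection_norm_le {p q : ℝ} [Fact (1 ≤ ENNReal.ofReal p)]
    (hpq : p.HolderConjugate q) (hp : 4 / 3 < p) (hp' : p < 4) :
    ∃ T : Lp ℂ (ENNReal.ofReal p) hartogsMeasure →L[ℂ] Lp ℂ (ENNReal.ofReal p) hartogsMeasure,
      IsBergmanProjectionOnLp (ENNReal.ofReal p) T ∧
      (∀ g, T g =ᵐ[hartogsMeasure] hartogsIntegral g) ∧
        ‖T‖ ≤ 1584 * ((4 - p) ^ (-(1 / p)) * (3 * p - 4) ^ (-(1 / q))) := by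
  obtain ⟨hq, hq'⟩ := hpq.bounds hp hp'
  obtain ⟨T, hT, hTn⟩ := exists_hartogsIntegral_operator hpq hp hp' hq hq'
  refine ⟨T, isBergmanProjectionOnLp_of_ae_eq hT, hT, hTn.trans ?_⟩
  -- The constant is `1584 = 16 · 3 + 192 · 8`.
  have h1 := (conj_bounds_comparable hpq hp hp').2
  have h2 := one_eighth_le hpq hp hp'
  linarith

theorem eLpNorm_hartogsIntegral_hartogsTestFunction {p q : ℝ} (hp0 : 0 < p) (hp' : p < 4)
    (hq' : q < 4) :
    eLpNorm (hartogsIntegral (hartogsTestFunction q)) (ENNReal.ofReal p) hartogsMeasure =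
      ENNReal.ofReal (2 / (4 - q) * (2 * Real.pi ^ 2 / (4 - p)) ^ (1 / p)) := by
  have h4q : 0 < 4 - q := by linarith
  have h1 : hartogsIntegral (hartogsTestFunction q) =ᵐ[hartogsMeasure]
      ((2 / (4 - q) : ℝ) : ℂ) • fun z : ℂ × ℂ => z.2⁻¹ := by
    filter_upwards [ae_restrict_mem isOpen_hartogsTriangle.measurableSet] with z hz
    exact hartogsIntegral_hartogsTestFunction hq' hz
  rw [eLpNorm_congr_ae h1, eLpNorm_const_smul, eLpNorm_inv_snd hp0 hp',
    ENNReal.ofReal_mul (by positivity), ← ofReal_norm, Complex.norm_of_nonneg (by positivity)]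

/-- The powers of `2π²` cancel, and `(4 - q)^(-1 + 1/p) = (4 - q)^(-1/q)`. -/
theorem testFunction_quotient_eq {p q : ℝ} (hpq : p.HolderConjugate q) (hp' : p < 4)
    (hq' : q < 4) :
    2 / (4 - q) * (2 * Real.pi ^ 2 / (4 - p)) ^ (1 / p) / (2 * Real.pi ^ 2 / (4 - q)) ^ (1 / p) =
      2 * ((4 - p) ^ (-(1 / p)) * (4 - q) ^ (-(1 / q))) := by
  have h4p : 0 < 4 - p := by linarith
  have h4q : 0 < 4 - q := by linarith
  have hpi := Real.pi_pos
  have hinv := hpq.inv_add_inv_eq_one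
  have h1 : (4 - q) ^ (-(1 / q)) = (4 - q) ^ (1 / p) / (4 - q) := by
    rw [← Real.rpow_sub_one h4q.ne']
    congr 1
    rw [one_div, one_div]
    linarith
  rw [h1, Real.div_rpow (by positivity) h4p.le, Real.div_rpow (by positivity) h4q.le,
    Real.rpow_neg h4p.le]
  have : 0 < (2 * Real.pi ^ 2) ^ (1 / p) := by positivity
  have : 0 < (4 - p) ^ (1 / p) := by positivity
  have : 0 < (4 - q) ^ (1 / p) := by positivity
  field_simp

/-! ### Unboundedness outside the range `4/3 < p < 4`. -/

theorem lintegral_Ioo_inv_eq_top : ∫⁻ r in Set.Ioo (0 : ℝ) 1, ENNReal.ofReal r⁻¹ = ∞ := by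
  by_contra h
  obtain ⟨n, hn⟩ := ENNReal.exists_nat_gt h
  have h1 := lintegral_Ioo_inv (Real.exp_pos (-n)) (Real.exp_le_one_iff.2 (by simp))
  rw [Real.log_exp, neg_neg, ENNReal.ofReal_natCast] at h1
  rw [← h1] at hn
  exact hn.not_ge (lintegral_mono_set (Set.Ioo_subset_Ioo_left (Real.exp_pos _).le))

/-- On a finite measure space it suffices to treat `p = 4`, where `r³ · r⁻⁴ = 1/r` diverges at the
origin. -/
theorem not_memLp_inv_snd {p : ℝ≥0∞} (hp : 4 ≤ p) :
    ¬ MemLp (fun z : ℂ × ℂ => z.2⁻¹) p hartogsMeasure := by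
  intro h
  have h1 := (eLpNorm_lt_top_iff_lintegral_rpow_enorm_lt_top (by norm_num) (by norm_num)).1
    (h.mono_exponent hp).2
  have h2 : ∀ᵐ z ∂hartogsMeasure, ‖z.2⁻¹‖ₑ ^ (4 : ℝ≥0∞).toReal =
      ENNReal.ofReal ((‖z.2‖ ^ 4)⁻¹) := by
    filter_upwards [ae_restrict_mem isOpen_hartogsTriangle.measurableSet] with z hz
    rw [← ofReal_norm, norm_inv, ENNReal.toReal_ofNat,
      ENNReal.ofReal_rpow_of_nonneg (by positivity) (by norm_num), ← inv_pow]
    norm_cast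
  rw [lintegral_congr_ae h2,
    lintegral_hartogs_norm_snd (φ := fun r => ENNReal.ofReal ((r ^ 4)⁻¹)) (by fun_prop),
    setLIntegral_congr_fun (g := fun r => ENNReal.ofReal r⁻¹) measurableSet_Ioo,
    lintegral_Ioo_inv_eq_top, ENNReal.mul_top] at h1
  · exact lt_irrefl _ h1
  · rw [ne_eq, ENNReal.ofReal_eq_zero, not_le]
    positivity
  · intro r hr
    have := hr.1
    simp only
    rw [← ENNReal.ofReal_mul (by positivity)]
    congr 1
    field_simp

theorem not_isBergmanProjectionOnLp_of_four_le {p : ℝ≥0∞} [Fact (1 ≤ p)] (hp : 4 ≤ p)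
    (T : Lp ℂ p hartogsMeasure →L[ℂ] Lp ℂ p hartogsMeasure) : ¬ IsBergmanProjectionOnLp p T := by
  intro hT
  have hconj := measurable_conj_complex
  -- At exponent `0` this is `z̄₂`, which is bounded and so lies in every `L^s`, while its
  -- projection is `1/(2 z₂)`.
  set f : ℂ × ℂ → ℂ := hartogsTestFunction 0 with hf
  have hfm : Measurable f := by
    rw [hf]; unfold hartogsTestFunction; fun_prop
  have hb : ∀ᵐ z ∂hartogsMeasure, ‖f z‖ ≤ 1 := by
    filter_upwards [ae_restrict_mem isOpen_hartogsTriangle.measurableSet] with z hz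
    simp only [hf, hartogsTestFunction, neg_zero, Real.rpow_zero, Complex.ofReal_one, one_mul,
      RCLike.norm_conj]
    exact hz.2.le
  have hmem : ∀ s : ℝ≥0∞, MemLp f s hartogsMeasure := fun s =>
    MemLp.of_bound hfm.aestronglyMeasurable 1 hb
  have h1 := hT.ae_eq_hartogsIntegral (hmem 2) (hmem p)
  have h2 : MemLp (hartogsIntegral f) p hartogsMeasure := (Lp.memLp _).ae_eq h1
  refine not_memLp_inv_snd hp ((h2.const_mul 2).ae_eq ?_)
  filter_upwards [ae_restrict_mem isOpen_hartogsTriangle.measurableSet] with z hz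
  rw [hf, hartogsIntegral_hartogsTestFunction (by norm_num) hz]
  push_cast
  ring

/-- The radial profile `r⁻⁴ 1_{r > ε}`. -/
noncomputable def truncatedProfile (ε : ℝ) : ℝ → ℝ := (Set.Ioi ε).indicator fun r => (r ^ 4)⁻¹

theorem measurable_truncatedProfile (ε : ℝ) : Measurable (truncatedProfile ε) := by
  unfold truncatedProfile
  exact Measurable.indicator (by fun_prop) measurableSet_Ioi

theorem norm_truncatedProfile_le {ε : ℝ} (hε : 0 < ε) (r : ℝ) :
    ‖truncatedProfile ε r‖ ≤ (ε ^ 4)⁻¹ := by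
  unfold truncatedProfile
  by_cases h : r ∈ Set.Ioi ε
  · rw [Set.indicator_of_mem h, Real.norm_of_nonneg (by positivity)]
    have : ε ≤ r := le_of_lt h
    gcongr
  · rw [Set.indicator_of_notMem h, norm_zero]
    positivity

/-- The function `|z₂|⁻⁴ z̄₂`, truncated to `|z₂| > ε`. -/
noncomputable def truncatedFunction (ε : ℝ) (z : ℂ × ℂ) : ℂ :=
  (truncatedProfile ε ‖z.2‖ : ℂ) * (starRingEnd ℂ) z.2

theorem measurable_truncatedFunction (ε : ℝ) : Measurable (truncatedFunction ε) := by
  have := measurable_conj_complex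
  have := measurable_truncatedProfile ε
  unfold truncatedFunction
  fun_prop

theorem memLp_truncatedFunction {ε : ℝ} (hε : 0 < ε) (p : ℝ≥0∞) :
    MemLp (truncatedFunction ε) p hartogsMeasure := by
  refine MemLp.of_bound (measurable_truncatedFunction ε).aestronglyMeasurable ((ε ^ 4)⁻¹ * 1) ?_
  filter_upwards [ae_restrict_mem isOpen_hartogsTriangle.measurableSet] with z hz
  unfold truncatedFunction
  rw [norm_mul, RCLike.norm_conj, Complex.norm_real]
  have h1 := norm_truncatedProfile_le hε ‖z.2‖
  have h2 := hz.2.le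
  gcongr

/-- Where it is nonzero, `|f|^(4/3) = (|z₂|⁻³)^(4/3) = |z₂|⁻⁴`, so the integral is exactly
logarithmic in `ε`. -/
theorem eLpNorm_truncatedFunction {ε : ℝ} (hε : 0 < ε) (hε1 : ε ≤ 1) :
    eLpNorm (truncatedFunction ε) (ENNReal.ofReal (4 / 3)) hartogsMeasure =
      ENNReal.ofReal ((2 * Real.pi ^ 2 * -Real.log ε) ^ (3 / 4 : ℝ)) := by
  have hl : 0 ≤ -Real.log ε := by linarith [Real.log_nonpos hε.le hε1]
  rw [eLpNorm_eq_lintegral_rpow_enorm_toReal (by norm_num) ENNReal.ofReal_ne_top,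
    ENNReal.toReal_ofReal (by norm_num), show (1 / (4 / 3) : ℝ) = 3 / 4 by norm_num,
    ← ENNReal.ofReal_rpow_of_nonneg (by positivity) (by norm_num)]
  congr 1
  have h1 : ∀ᵐ z ∂hartogsMeasure, ‖truncatedFunction ε z‖ₑ ^ (4 / 3 : ℝ) =
      (Set.Ioi ε).indicator (fun r => ENNReal.ofReal ((r ^ 4)⁻¹)) ‖z.2‖ := by
    filter_upwards [ae_restrict_mem isOpen_hartogsTriangle.measurableSet] with z hz
    have h0 := norm_pos_iff.2 (snd_ne_zero_of_mem_hartogsTriangle hz)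
    unfold truncatedFunction truncatedProfile
    by_cases h : ‖z.2‖ ∈ Set.Ioi ε
    · rw [Set.indicator_of_mem h, Set.indicator_of_mem h, ← ofReal_norm, norm_mul,
        RCLike.norm_conj, Complex.norm_of_nonneg (by positivity),
        ENNReal.ofReal_rpow_of_nonneg (by positivity) (by norm_num)]
      congr 1
      have e : (‖z.2‖ ^ 4)⁻¹ * ‖z.2‖ = ‖z.2‖ ^ (-3 : ℝ) := by
        rw [Real.rpow_neg h0.le]
        norm_cast
        field_simp
      rw [e, ← Real.rpow_mul h0.le, show (-3 * (4 / 3) : ℝ) = -4 by norm_num,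
        Real.rpow_neg h0.le]
      norm_cast
    · rw [Set.indicator_of_notMem h, Set.indicator_of_notMem h]
      simp
  rw [lintegral_congr_ae h1, lintegral_hartogs_norm_snd
    (Measurable.indicator (by fun_prop) measurableSet_Ioi),
    ENNReal.ofReal_mul (p := 2 * Real.pi ^ 2) (by positivity), ← lintegral_Ioo_inv hε hε1]
  congr 1
  have h2 : ∀ r ∈ Set.Ioo (0 : ℝ) 1, ENNReal.ofReal (r ^ 3) *
      (Set.Ioi ε).indicator (fun r => ENNReal.ofReal ((r ^ 4)⁻¹)) r =
      (Set.Ioi ε).indicator (fun r => ENNReal.ofReal r⁻¹) r := fun r hr => by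
    have := hr.1
    by_cases h : r ∈ Set.Ioi ε
    · rw [Set.indicator_of_mem h, Set.indicator_of_mem h, ← ENNReal.ofReal_mul (by positivity)]
      congr 1
      field_simp
    · rw [Set.indicator_of_notMem h, Set.indicator_of_notMem h, mul_zero]
  rw [setLIntegral_congr_fun measurableSet_Ioo h2, setLIntegral_indicator measurableSet_Ioi]
  congr 2
  ext r
  simp only [Set.mem_inter_iff, Set.mem_Ioi, Set.mem_Ioo]
  exact ⟨fun h => ⟨h.1, h.2.2⟩, fun h => ⟨h.1, hε.trans h.1, h.2⟩⟩

theorem hartogsIntegral_truncatedFunction {ε : ℝ} (hε : 0 < ε) (hε1 : ε ≤ 1) {z : ℂ × ℂ}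
    (hz : z ∈ hartogsTriangle) :
    hartogsIntegral (truncatedFunction ε) z = ((2 * -Real.log ε : ℝ) : ℂ) * z.2⁻¹ := by
  have hm := measurable_truncatedProfile ε
  have hint : IntegrableOn (fun w : ℂ => ((truncatedProfile ε ‖w‖ * ‖w‖ ^ 2 : ℝ) : ℂ))
      (ball 0 1) := by
    refine Measure.integrableOn_of_bounded (M := (ε ^ 4)⁻¹ * 1 ^ 2) (by simp)
      (by fun_prop) ?_
    filter_upwards [ae_restrict_mem measurableSet_ball] with w hw
    have h1 := norm_truncatedProfile_le hε ‖w‖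
    have h2 : ‖w‖ ≤ 1 := by simpa using (mem_ball_zero_iff.1 hw).le
    rw [Complex.norm_real, norm_mul, norm_pow, norm_norm]
    gcongr
  have h := hartogsIntegral_radial hm hint hz
  refine h.trans ?_
  congr 3
  have h2 : ∀ r ∈ Set.Ioo (0 : ℝ) 1, r * (truncatedProfile ε r * r ^ 2) =
      (Set.Ioi ε).indicator (fun r => r⁻¹) r := fun r hr => by
    have := hr.1
    unfold truncatedProfile
    by_cases h : r ∈ Set.Ioi ε
    · rw [Set.indicator_of_mem h, Set.indicator_of_mem h]
      field_simp
    · rw [Set.indicator_of_notMem h, Set.indicator_of_notMem h, zero_mul, mul_zero]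
  have h3 : Set.Ioo (0 : ℝ) 1 ∩ Set.Ioi ε = Set.Ioo ε 1 := by
    ext r
    simp only [Set.mem_inter_iff, Set.mem_Ioi, Set.mem_Ioo]
    exact ⟨fun h => ⟨h.2, h.1.2⟩, fun h => ⟨⟨hε.trans h.1, h.2⟩, h.1⟩⟩
  rw [setIntegral_congr_fun measurableSet_Ioo h2, setIntegral_indicator measurableSet_Ioi, h3,
    ← integral_Ioc_eq_integral_Ioo, ← intervalIntegral.integral_of_le hε1,
    integral_inv_of_pos hε one_pos, one_div, Real.log_inv]

/-- With `L = log(1/ε)`, the image of the truncated function has norm proportional to `L`, but its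
own norm is at most a constant times `L^(3/4)`. -/
theorem not_isBergmanProjectionOnLp_of_le {p : ℝ≥0∞} [hp1 : Fact (1 ≤ p)]
    (hp : p ≤ ENNReal.ofReal (4 / 3))
    (T : Lp ℂ p hartogsMeasure →L[ℂ] Lp ℂ p hartogsMeasure) : ¬ IsBergmanProjectionOnLp p T := by
  intro hT
  have hinv : MemLp (fun z : ℂ × ℂ => z.2⁻¹) p hartogsMeasure :=
    (memLp_inv_snd (by norm_num) (by norm_num)).mono_exponent hp
  set N : ℝ := (eLpNorm (fun z : ℂ × ℂ => z.2⁻¹) p hartogsMeasure).toReal with hN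
  have hN0 : 0 < N := by
    refine ENNReal.toReal_pos (fun h0 => ?_) hinv.2.ne
    have hp0 : p ≠ 0 := (zero_lt_one.trans_le hp1.out).ne'
    have h1 := (eLpNorm_eq_zero_iff hinv.1 hp0).1 h0
    have h2 : ∀ᵐ z ∂hartogsMeasure, False := by
      filter_upwards [h1, ae_restrict_mem isOpen_hartogsTriangle.measurableSet] with z hz hz'
      exact inv_ne_zero (snd_ne_zero_of_mem_hartogsTriangle hz') hz
    have h3 := lintegral_hartogs_rpow_norm_snd (s := 0) (by norm_num)
    rw [Filter.eventually_false_iff_eq_bot, ae_eq_bot] at h2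
    rw [h2, lintegral_zero_measure] at h3
    have := ENNReal.ofReal_eq_zero.1 h3.symm
    have hpi := Real.pi_pos
    have : 0 < 2 * Real.pi ^ 2 / (4 - 0) := by positivity
    linarith
  -- The constant of the embedding of `L^(4/3)` into `L^p` on a finite measure space, which reduces
  -- all `p ≤ 4/3` to the endpoint.
  set V : ℝ≥0∞ := hartogsMeasure Set.univ ^ (1 / p.toReal - 1 / (ENNReal.ofReal (4 / 3)).toReal)
    with hV
  have hVt : V ≠ ∞ := by
    refine ENNReal.rpow_ne_top_of_nonneg ?_ (measure_ne_top _ _)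
    have hpt : p ≠ ∞ := ne_top_of_le_ne_top ENNReal.ofReal_ne_top hp
    have h1 : 0 < p.toReal := ENNReal.toReal_pos (zero_lt_one.trans_le hp1.out).ne' hpt
    rw [sub_nonneg]
    exact one_div_le_one_div_of_le h1 (ENNReal.toReal_mono ENNReal.ofReal_ne_top hp)
  set K : ℝ := ‖T‖ * ((2 * Real.pi ^ 2) ^ (3 / 4 : ℝ) * V.toReal) with hK
  have key : ∀ m : ℕ, 2 * (m : ℝ) ^ 4 * N ≤ K * m ^ 3 := by
    intro m
    -- Chosen so that `log(1/ε) = m⁴` and its `3/4` power is the integer power `m³`.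
    set ε := Real.exp (-(m : ℝ) ^ 4) with hε
    have hε0 : 0 < ε := Real.exp_pos _
    have hε1 : ε ≤ 1 := Real.exp_le_one_iff.2 (by simp only [Left.neg_nonpos_iff]; positivity)
    have hlog : -Real.log ε = (m : ℝ) ^ 4 := by rw [hε, Real.log_exp, neg_neg]
    have h1 := hT.ae_eq_hartogsIntegral (memLp_truncatedFunction hε0 2)
      (memLp_truncatedFunction hε0 p)
    have h2 : hartogsIntegral (truncatedFunction ε) =ᵐ[hartogsMeasure]
        ((2 * -Real.log ε : ℝ) : ℂ) • fun z : ℂ × ℂ => z.2⁻¹ := by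
      filter_upwards [ae_restrict_mem isOpen_hartogsTriangle.measurableSet] with z hz
      exact hartogsIntegral_truncatedFunction hε0 hε1 hz
    have h3 := T.le_opNorm (memLp_truncatedFunction hε0 p).toLp
    rw [Lp.norm_def, Lp.norm_toLp, eLpNorm_congr_ae (h1.trans h2), eLpNorm_const_smul,
      ENNReal.toReal_mul, ← hN, toReal_enorm, Complex.norm_real, hlog,
      Real.norm_of_nonneg (by positivity)] at h3
    refine h3.trans ?_
    rw [hK, mul_assoc]
    gcongr
    have h4 := eLpNorm_le_eLpNorm_mul_rpow_measure_univ hp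
      (memLp_truncatedFunction hε0 p).1
    rw [eLpNorm_truncatedFunction hε0 hε1, hlog, ← hV] at h4
    have h5 := ENNReal.toReal_mono (ENNReal.mul_ne_top ENNReal.ofReal_ne_top hVt) h4
    rw [ENNReal.toReal_mul, ENNReal.toReal_ofReal (by positivity),
      Real.mul_rpow (by positivity) (by positivity), ← Real.rpow_natCast (m : ℝ) 4,
      ← Real.rpow_mul (by positivity),
      show ((4 : ℕ) : ℝ) * (3 / 4) = ((3 : ℕ) : ℝ) by norm_num, Real.rpow_natCast] at h5
    refine h5.trans (le_of_eq ?_)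
    ring
  obtain ⟨m, hm⟩ := exists_nat_gt (max 1 (K / (2 * N)))
  have hm1 : 1 < (m : ℝ) := (le_max_left _ _).trans_lt hm
  have hm2 := (le_max_right _ _).trans_lt hm
  rw [div_lt_iff₀ (by positivity)] at hm2
  have h6 := key m
  have h7 : 0 < (m : ℝ) ^ 3 := by positivity
  nlinarith

/-! ### The main theorem. -/

theorem mainTheorem5 :
    (∀ (p : ℝ≥0∞) [Fact (1 ≤ p)],
      (∃ T : Lp ℂ p hartogsMeasure →L[ℂ] Lp ℂ p hartogsMeasure, IsBergmanProjectionOnLp p T) ↔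
        4 / 3 < p ∧ p < 4) ∧
    (∃ C : ℝ, 0 < C ∧ ∀ (p q : ℝ) [Fact (1 ≤ ENNReal.ofReal p)], p.HolderConjugate q →
      4 / 3 < p → p < 4 →
      ∀ T : Lp ℂ (ENNReal.ofReal p) hartogsMeasure →L[ℂ] Lp ℂ (ENNReal.ofReal p) hartogsMeasure,
        IsBergmanProjectionOnLp (ENNReal.ofReal p) T →
          ‖T‖ ≤ C * ((4 - p) ^ (-(1 / p)) * (3 * p - 4) ^ (-(1 / q)))) ∧
    (∃ c C : ℝ, 0 < c ∧ 0 < C ∧ ∀ (p q : ℝ) [Fact (1 ≤ ENNReal.ofReal p)], p.HolderConjugate q →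
      4 / 3 < p → p < 4 →
      ∃ h : MemLp (hartogsTestFunction q) (ENNReal.ofReal p) hartogsMeasure,
        ∀ T : Lp ℂ (ENNReal.ofReal p) hartogsMeasure →L[ℂ] Lp ℂ (ENNReal.ofReal p) hartogsMeasure,
          IsBergmanProjectionOnLp (ENNReal.ofReal p) T →
            c * ((4 - p) ^ (-(1 / p)) * (3 * p - 4) ^ (-(1 / q))) ≤ ‖T h.toLp‖ / ‖h.toLp‖ ∧
            ‖T h.toLp‖ / ‖h.toLp‖ ≤ C * ((4 - p) ^ (-(1 / p)) * (3 * p - 4) ^ (-(1 / q)))) := by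
  have h43 : (4 / 3 : ℝ≥0∞) = ENNReal.ofReal (4 / 3) := by
    rw [ENNReal.ofReal_div_of_pos (by norm_num)]; simp
  -- The quotient for the test function is exactly `2 (4 - p)^(-1/p) (4 - q)^(-1/q)`; the comparison
  -- factors `1/3` and `3` give `2/3` and `6`.
  refine ⟨fun p _ => ⟨?_, ?_⟩, ⟨1584, by norm_num, ?_⟩, ⟨2 / 3, 6, by norm_num, by norm_num, ?_⟩⟩
  · rintro ⟨T, hT⟩
    refine ⟨lt_of_not_ge fun h => ?_, lt_of_not_ge fun h => ?_⟩
    · exact not_isBergmanProjectionOnLp_of_le (h.trans h43.le) T hT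
    · exact not_isBergmanProjectionOnLp_of_four_le h T hT
  · rintro ⟨h1, h2⟩
    obtain ⟨r, rfl⟩ : ∃ r : ℝ, p = ENNReal.ofReal r :=
      ⟨p.toReal, (ENNReal.ofReal_toReal (h2.trans ENNReal.ofNat_lt_top).ne).symm⟩
    rw [h43] at h1
    have h1' : 4 / 3 < r := (ENNReal.ofReal_lt_ofReal_iff_of_nonneg (by norm_num)).1 h1
    have h2' : r < 4 := by
      rw [← ENNReal.ofReal_ofNat 4] at h2
      exact (ENNReal.ofReal_lt_ofReal_iff (by norm_num)).1 h2
    obtain ⟨T, hT, -⟩ := exists_bergmanProjection_norm_le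
      (Real.HolderConjugate.conjExponent (p := r) (by linarith)) h1' h2'
    exact ⟨T, hT⟩
  · intro p q _ hpq hp hp' T hT
    obtain ⟨S, hS, -, hSn⟩ := exists_bergmanProjection_norm_le hpq hp hp'
    rwa [hT.unique ENNReal.ofReal_ne_top hS]
  · intro p q _ hpq hp hp'
    obtain ⟨hq, hq'⟩ := hpq.bounds hp hp'
    refine ⟨memLp_hartogsTestFunction hpq hq', fun T hT => ?_⟩
    -- The test function is not in `L²` when `q ≥ 3`, so the defining property of `T` does not apply
    -- to it directly. Uniqueness identifies `T` with `S`, whose integral formula holds on all of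
    -- `L^p`.
    obtain ⟨S, hS, hSf, -⟩ := exists_bergmanProjection_norm_le hpq hp hp'
    have h4p : 0 < 4 - p := by linarith
    have h4q : 0 < 4 - q := by linarith
    have hTf := hSf (memLp_hartogsTestFunction hpq hq').toLp
    rw [hartogsIntegral_congr_ae (memLp_hartogsTestFunction hpq hq').coeFn_toLp] at hTf
    rw [hT.unique ENNReal.ofReal_ne_top hS, Lp.norm_def, Lp.norm_toLp, eLpNorm_congr_ae hTf,
      eLpNorm_hartogsIntegral_hartogsTestFunction hpq.pos hp' hq',
      eLpNorm_hartogsTestFunction hpq hq', ENNReal.toReal_ofReal (by positivity),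
      ENNReal.toReal_ofReal (by positivity), testFunction_quotient_eq hpq hp' hq']
    obtain ⟨h5, h6⟩ := conj_bounds_comparable hpq hp hp'
    constructor <;> linarith
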